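/- Let $M$ be a smooth oriented three-dimensional manifold (Hausdorff, without boundary), $\nabla_a$ a smooth torsion-free connection on $TM$, and $\epsilon_{abc}$ a smooth volume form with $\nabla_a\epsilon_{bcd}=0$; let $\epsilon^{abc}$ be the dual skew tensor, normalised by $\epsilon^{abc}\epsilon_{abc}=6$. Round brackets denote symmetrisation (with factor $\tfrac12$ on two indices). Let $V^{ab}{}_c=V^{(ab)}{}_c$ be the Weyl tensor of $\nabla_a$, i.e. the tensor determined by $$2\epsilon^{de(a}\nabla_d\nabla_eX^{b)}=V^{ab}{}_cX^c\quad\text{for all smooth vector fields }X^c,$$ and suppose that $V^{ab}{}_c$ does not vanish identically on $M$. Suppose that the projective structure defined by $\nabla_a$ is metrisable: there is a smooth non-degenerate symmetric tensor $g_{ab}$ on $M$ (of any signature) whose Levi-Civita connection has the same geodesics as $\nabla_a$, as unparameterised curves. Then the composition $$T_{ab}\;\longmapsto\;T_{ad}V^{a(b}{}_e\epsilon^{c)de}\;\longmapsto\;\det\bigl(T_{ad}V^{a(b}{}_e\epsilon^{c)de}\bigr),$$ defined on smooth symmetric covariant $2$-tensors $T_{ab}$ on $M$, where $\det(\tau^{bc})=\tau^{ab}\tau^{cd}\tau^{ef}\epsilon_{ace}\epsilon_{bdf}$,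 does not vanish identically. That is, there are a smooth symmetric tensor $T_{ab}$ on $M$ and a point of $M$ at which $\det\bigl(T_{ad}V^{a(b}{}_e\epsilon^{c)de}\bigr)\neq 0$, so that $T_{ad}V^{a(b}{}_e\epsilon^{c)de}$ is non-degenerate there. -/

import Mathlib

open scoped Manifold ContDiff Topology
open Bundle

noncomputable section

/-- Model space of 3-manifolds. -/
abbrev R3 : Type := EuclideanSpace ℝ (Fin 3)

section Tensors

variable (M : Type*) [TopologicalSpace M] [ChartedSpace R3 M] [IsManifold (𝓡 3) ∞ M]

/-- An affine connection on `M`, i.e. a covariant derivative on `TM`. In Mathlib's argument order,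
`cov Y x u` is the value at `x` of `∇_u Y`, for `u` a tangent vector at `x`. -/
abbrev AffineConnection : Type _ :=
  CovariantDerivative (𝓡 3) R3 (TangentSpace (𝓡 3) : M → Type)

/-- Smooth symmetric covariant 2-tensor fields `T_{ab}` on `M`. -/
structure SymTwoTensor where
  toFun (x : M) : TangentSpace (𝓡 3) x →L[ℝ] TangentSpace (𝓡 3) x →L[ℝ] ℝ
  symm (x : M) (u v : TangentSpace (𝓡 3) x) : toFun x u v = toFun x v u
  contMDiff : ContMDiff (𝓡 3) ((𝓡 3).prod 𝓘(ℝ, R3 →L[ℝ] R3 →L[ℝ] ℝ)) ∞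
    (fun x ↦ TotalSpace.mk' (R3 →L[ℝ] R3 →L[ℝ] ℝ) x (toFun x))

/-- Metrics of arbitrary signature: non-degenerate smooth symmetric covariant 2-tensors. -/
structure MetricTensor extends SymTwoTensor M where
  nondegenerate (x : M) (u : TangentSpace (𝓡 3) x) : (∀ v, toFun x u v = 0) → u = 0

/-- Smooth volume forms: nowhere vanishing 3-forms `ε_{abc}`. -/
structure VolumeForm where
  toFun (x : M) : TangentSpace (𝓡 3) x [⋀^Fin 3]→ₗ[ℝ] ℝ
  ne_zero (x : M) : toFun x ≠ 0
  smooth (Y : Fin 3 → Π x : M, TangentSpace (𝓡 3) x) :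
    (∀ i, ContMDiff (𝓡 3) (𝓡 3).tangent ∞
      (fun x ↦ (TotalSpace.mk' R3 x (Y i x) : TangentBundle (𝓡 3) M))) →
    ContMDiff (𝓡 3) 𝓘(ℝ) ∞ (fun x ↦ toFun x (fun i ↦ Y i x))

end Tensors

section Connections

variable {M : Type*} [TopologicalSpace M] [ChartedSpace R3 M] [IsManifold (𝓡 3) ∞ M]

/-- `∇ε = 0`. -/
def IsParallelVolume (cov : AffineConnection M) (ε : VolumeForm M) : Prop :=
  ∀ (x : M) (u : TangentSpace (𝓡 3) x) (Y : Fin 3 → Π x : M, TangentSpace (𝓡 3) x),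
    (∀ i, MDifferentiableAt (𝓡 3) (𝓡 3).tangent
      (fun y ↦ (TotalSpace.mk' R3 y (Y i y) : TangentBundle (𝓡 3) M)) x) →
    mvfderiv (𝓡 3) (fun y ↦ ε.toFun y (fun i ↦ Y i y)) x u =
      ∑ i, ε.toFun x (Function.update (fun j ↦ Y j x) i (cov (Y i) x u))

/-- `D` is the Levi-Civita connection of `g`: smooth, torsion-free, and `Dg = 0`. -/
structure IsLeviCivita (D : AffineConnection M) (g : MetricTensor M) : Prop where
  smooth : CovariantDerivative.ContMDiffCovariantDerivative D ∞
  torsion_eq_zero : D.torsion = 0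
  metric : ∀ (x : M) (u : TangentSpace (𝓡 3) x) (Y Z : Π x : M, TangentSpace (𝓡 3) x),
    MDifferentiableAt (𝓡 3) (𝓡 3).tangent
      (fun y ↦ (TotalSpace.mk' R3 y (Y y) : TangentBundle (𝓡 3) M)) x →
    MDifferentiableAt (𝓡 3) (𝓡 3).tangent
      (fun y ↦ (TotalSpace.mk' R3 y (Z y) : TangentBundle (𝓡 3) M)) x →
    mvfderiv (𝓡 3) (fun y ↦ g.toFun y (Y y) (Z y)) x u =
      g.toFun x (D Y x u) (Z x) + g.toFun x (Y x) (D Z x u)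

/-- The velocity `γ'(t)` of a curve in `M`. -/
def velocity (γ : ℝ → M) (t : ℝ) : TangentSpace (𝓡 3) (γ t) :=
  mfderiv 𝓘(ℝ) (𝓡 3) γ t (1 : ℝ)

/-- `∇_{γ'} γ' = a` at time `t`, for a curve `γ` regular near `t`: the derivative along `γ'(t)` of
a local vector field that extends the velocity of `γ` near time `t`. Such an extension exists since
`γ` is regular, and the result does not depend on it. -/
def HasAcceleration (cov : AffineConnection M) (γ : ℝ → M) (t : ℝ)
    (a : TangentSpace (𝓡 3) (γ t)) : Prop :=
  ∃ X : Π x : M, TangentSpace (𝓡 3) x,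
    ContMDiffAt (𝓡 3) (𝓡 3).tangent ∞
      (fun x ↦ (TotalSpace.mk' R3 x (X x) : TangentBundle (𝓡 3) M)) (γ t) ∧
    (∀ᶠ s in 𝓝 t, X (γ s) = velocity γ s) ∧
    cov X (γ t) (velocity γ t) = a

/-- `γ` restricted to the open interval `s` is an unparameterised geodesic of `cov`: a smooth
regular curve whose acceleration is everywhere proportional to its velocity (equivalently, one that
can be reparameterised so as to satisfy `∇_{γ'} γ' = 0`). -/
structure IsUnparamGeodesicOn (cov : AffineConnection M) (γ : ℝ → M) (s : Set ℝ) : Prop where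
  smooth : ContMDiffOn 𝓘(ℝ) (𝓡 3) ∞ γ s
  regular : ∀ t ∈ s, velocity γ t ≠ 0
  accel : ∀ t ∈ s, ∃ c : ℝ, HasAcceleration cov γ t (c • velocity γ t)

/-- Two connections are projectively equivalent if they have the same unparameterised geodesics. -/
def ProjectivelyEquivalent (cov cov' : AffineConnection M) : Prop :=
  ∀ (γ : ℝ → M) (s : Set ℝ), IsOpen s → s.OrdConnected →
    (IsUnparamGeodesicOn cov γ s ↔ IsUnparamGeodesicOn cov' γ s)

/-- The projective structure of `cov` is metrisable: some metric on `M`, of any signature, has a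
Levi-Civita connection projectively equivalent to `cov`. -/
def IsMetrisable (cov : AffineConnection M) : Prop :=
  ∃ (g : MetricTensor M) (D : AffineConnection M),
    IsLeviCivita D g ∧ ProjectivelyEquivalent D cov

/-- The second covariant derivative `u^d w^e ∇_d ∇_e Z^b` at `x`, that is
`∇_u (∇_W Z) - ∇_{∇_u W} Z` for a vector field `W` extending `w` (the choice is immaterial). -/
def secondCov (cov : AffineConnection M) (Z : Π x : M, TangentSpace (𝓡 3) x) (x : M)
    (u w : TangentSpace (𝓡 3) x) : TangentSpace (𝓡 3) x :=
  cov (fun y ↦ cov Z y (FiberBundle.extend R3 w y)) x u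
    - cov Z x (cov (FiberBundle.extend R3 w) x u)

/-- Components `ε_{ijk}` of a volume form in a basis `B` of `T_xM`. -/
def VolumeForm.lower (ε : VolumeForm M) {x : M} (B : Module.Basis (Fin 3) ℝ (TangentSpace (𝓡 3) x))
    (i j k : Fin 3) : ℝ :=
  ε.toFun x ![B i, B j, B k]

/-- Components `ε^{ijk}` of the dual totally skew contravariant tensor, normalised by
`ε^{ijk} ε_{ijk} = 6`. -/
def VolumeForm.upper (ε : VolumeForm M) {x : M} (B : Module.Basis (Fin 3) ℝ (TangentSpace (𝓡 3) x))
    (i j k : Fin 3) : ℝ :=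
  ε.lower B i j k / ε.lower B 0 1 2 ^ 2

/-- Components `V^{ab}_c` in the basis `B` of `T_xM` of the Weyl tensor, which is determined by
`2 ε^{de(a} ∇_d ∇_e X^{b)} = V^{ab}_c X^c` for all vector fields `X`. The component with lower
index `c` is obtained from any `X` that extends the basis vector `B c`. -/
def weyl (cov : AffineConnection M) (ε : VolumeForm M) {x : M}
    (B : Module.Basis (Fin 3) ℝ (TangentSpace (𝓡 3) x)) (a b c : Fin 3) : ℝ :=
  ∑ d, ∑ e,
    (ε.upper B d e a * B.repr (secondCov cov (FiberBundle.extend R3 (B c)) x (B d) (B e)) b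
      + ε.upper B d e b * B.repr (secondCov cov (FiberBundle.extend R3 (B c)) x (B d) (B e)) a)

/-- Components of `T_{ad} V^{a(b}_e ε^{c)de}` in the basis `B` of `T_xM`; round brackets denote
symmetrisation with the factor `1/2`. -/
def weylPencil (cov : AffineConnection M) (ε : VolumeForm M) (T : SymTwoTensor M) {x : M}
    (B : Module.Basis (Fin 3) ℝ (TangentSpace (𝓡 3) x)) (b c : Fin 3) : ℝ :=
  ∑ a, ∑ d, ∑ e, T.toFun x (B a) (B d) *
    ((weyl cov ε B a b e * ε.upper B c d e + weyl cov ε B a c e * ε.upper B b d e) / 2)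

/-- `det τ = τ^{ab} τ^{cd} τ^{ef} ε_{ace} ε_{bdf}`, for `τ` given by its components in `B`. -/
def tensorDet (ε : VolumeForm M) {x : M} (B : Module.Basis (Fin 3) ℝ (TangentSpace (𝓡 3) x))
    (τ : Fin 3 → Fin 3 → ℝ) : ℝ :=
  ∑ a, ∑ b, ∑ c, ∑ d, ∑ e, ∑ f,
    τ a b * τ c d * τ e f * ε.lower B a c e * ε.lower B b d f

end Connections

end

/-!
The proof is local. At a point `x` where the Weyl tensor `V` of `∇` does not vanish, everything is
computed in the chart at `x`, where a connection is given by its Christoffel symbols `Γ`.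

*Reduction to the metric connection.* Let `D` be the Levi-Civita connection of a metric `g` with
the same unparameterised geodesics as `∇`. Following a geodesic of `D` through a given point in a
given direction `v` shows that the difference `A` of the Christoffel symbols satisfies `A(v, v) ∝ v`
(`exists_christoffel_sub_eq_smul`). As `A` is symmetric, `A(v, w) = η(v) w + η(w) v` for a covector
field `η` (`exists_christoffel_projective`), and the two curvatures differ by
`(P(u, w) - P(w, u)) c + P(u, c) w - P(w, c) u` for some `P`
(`exists_christoffelCurvature_projective`). The curvature of `∇` is trace-free since `∇` preserves a
volume form (`christoffelCurvature_trace`), and that of `D` is since it is skew for `g`. Hence `P` is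
symmetric, and its contribution to `V` cancels: `V` is the same contraction of the curvature of `D`
(`repr_projective_curvature`).

*Algebra in dimension three.* The lowered curvature of `D` is skew in two pairs of indices, so the
volume form turns it into a tensor `S` with two upper indices, symmetric by the Bianchi identity
(`dualCurvature`, `dualCurvature_isSymm`). With `H` the inverse metric, `V` is up to scale the
symmetrisation in `a`, `b` of `ε_{hck} H^{bh} S^{ak}` (`weylComponent_eq`), and the tensor formed
from `T` is, up to scale, `(T · H) S - (T · S) H` (`pencil_eq`). If `S` were a multiple of `H`, then
`V` would vanish. So some symmetric `T` satisfies `T · H = 0` and `T · S ≠ 0`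
(`exists_symm_orthogonal`), and for this `T` the tensor is a non-zero multiple of the non-degenerate
`H`. Both conditions on `T` are independent of the basis (`trace_mul_inv_basis_change`,
`trace_mul_dualCurvature_basis_change`), so the conclusion holds in every basis of `T_xM`. Finally
`T` is extended from `T_xM` to `M` with a bump function (`exists_symTwoTensor`).
-/

noncomputable section

/-! ### Vector fields and functions in a chart -/

section Chart

variable {M : Type*} [TopologicalSpace M] [ChartedSpace R3 M]

/-- The domain of the preferred chart at `x₀`. -/
abbrev chartDom (x₀ : M) : Set M := (extChartAt (𝓡 3) x₀).source

lemma chartDom_mem_nhds {x₀ y : M} (hy : y ∈ chartDom x₀) : chartDom x₀ ∈ 𝓝 y :=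
  (isOpen_extChartAt_source x₀).mem_nhds hy

lemma eventuallyEq_comp_symm_comp {x₀ y : M} (hy : y ∈ chartDom x₀) {α : Type*} (f : M → α) :
    (f ∘ (extChartAt (𝓡 3) x₀).symm) ∘ extChartAt (𝓡 3) x₀ =ᶠ[𝓝 y] f := by
  filter_upwards [chartDom_mem_nhds hy] with z hz
  simp only [Function.comp_apply, (extChartAt (𝓡 3) x₀).left_inv hz]

variable [IsManifold (𝓡 3) ∞ M]

/-- The chart at `x₀` identifies `T_yM` with the model space. This is that identification. -/
def toChart (x₀ y : M) : TangentSpace (𝓡 3) y →L[ℝ] R3 :=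
  (trivializationAt R3 (TangentSpace (𝓡 3)) x₀).continuousLinearMapAt ℝ y

/-- The inverse of `toChart`. -/
def fromChart (x₀ y : M) : R3 →L[ℝ] TangentSpace (𝓡 3) y :=
  (trivializationAt R3 (TangentSpace (𝓡 3)) x₀).symmL ℝ y

lemma mem_baseSet_of_mem_chartDom {x₀ y : M} (hy : y ∈ chartDom x₀) :
    y ∈ (trivializationAt R3 (TangentSpace (𝓡 3)) x₀).baseSet := by
  simpa [chartDom] using hy

lemma toChart_fromChart {x₀ y : M} (hy : y ∈ chartDom x₀) (v : R3) :
    toChart x₀ y (fromChart x₀ y v) = v :=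
  Trivialization.continuousLinearMapAt_symmL _ (mem_baseSet_of_mem_chartDom hy) v

lemma fromChart_toChart {x₀ y : M} (hy : y ∈ chartDom x₀) (u : TangentSpace (𝓡 3) y) :
    fromChart x₀ y (toChart x₀ y u) = u :=
  Trivialization.symmL_continuousLinearMapAt _ (mem_baseSet_of_mem_chartDom hy) u

lemma toChart_eq_snd {x₀ y : M} (hy : y ∈ chartDom x₀) (u : TangentSpace (𝓡 3) y) :
    toChart x₀ y u = (trivializationAt R3 (TangentSpace (𝓡 3)) x₀ ⟨y, u⟩).2 := by
  rw [toChart, Trivialization.continuousLinearMapAt_apply, Trivialization.coe_linearMapAt_of_mem _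
    (mem_baseSet_of_mem_chartDom hy)]

lemma toChart_eq_mfderiv {x₀ y : M} (hy : y ∈ chartDom x₀) :
    toChart x₀ y = mfderiv (𝓡 3) 𝓘(ℝ, R3) (extChartAt (𝓡 3) x₀) y := by
  have : IsManifold (𝓡 3) 1 M := .of_le (n := ∞) (by simp)
  exact TangentBundle.continuousLinearMapAt_trivializationAt (by simpa [chartDom] using hy)

/-- At the base point of the chart the identification with the model space is the identity. -/
lemma toChart_self (x : M) (u : TangentSpace (𝓡 3) x) : toChart x x u = u := by
  have hx : x ∈ chartDom x := mem_extChartAt_source x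
  rw [toChart_eq_snd hx, TangentBundle.trivializationAt_apply]
  have := tangentCoordChange_self (I := 𝓡 3) (x := x) (z := x) (v := u) hx
  simpa [tangentCoordChange] using this

/-- The coordinate vector field of the chart at `x₀` with constant components `v`. -/
def coordField (x₀ : M) (v : R3) (y : M) : TangentSpace (𝓡 3) y := fromChart x₀ y v

lemma extend_eq_coordField {x y : M} (hy : y ∈ chartDom x) (v : TangentSpace (𝓡 3) x) :
    FiberBundle.extend R3 v y = coordField x (toChart x x v) y := by
  have hx : x ∈ chartDom x := mem_extChartAt_source x
  rw [FiberBundle.extend, ← toChart_eq_snd hx]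
  exact (Trivialization.symmL_apply _ (mem_baseSet_of_mem_chartDom hy) _).symm

/-- The components of a vector field in the chart at `x₀`, as a function on the model space. -/
def chartRep (x₀ : M) (Z : Π y : M, TangentSpace (𝓡 3) y) (p : R3) : R3 :=
  toChart x₀ ((extChartAt (𝓡 3) x₀).symm p) (Z ((extChartAt (𝓡 3) x₀).symm p))

lemma chartRep_extChartAt {x₀ y : M} (hy : y ∈ chartDom x₀) (Z : Π y : M, TangentSpace (𝓡 3) y) :
    chartRep x₀ Z (extChartAt (𝓡 3) x₀ y) = toChart x₀ y (Z y) := by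
  rw [chartRep, (extChartAt (𝓡 3) x₀).left_inv hy]

section Functions

variable {F : Type*} [NormedAddCommGroup F] [NormedSpace ℝ F]

lemma contMDiffAt_extChartAt_symm {x₀ y : M} (hy : y ∈ chartDom x₀) :
    ContMDiffAt 𝓘(ℝ, R3) (𝓡 3) ∞ (extChartAt (𝓡 3) x₀).symm (extChartAt (𝓡 3) x₀ y) :=
  (contMDiffOn_extChartAt_symm x₀).contMDiffAt
    (extChartAt_target_mem_nhds' ((extChartAt (𝓡 3) x₀).map_source hy))

lemma contMDiffAt_chart {x₀ y : M} (hy : y ∈ chartDom x₀) :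
    ContMDiffAt (𝓡 3) 𝓘(ℝ, R3) ∞ (extChartAt (𝓡 3) x₀) y :=
  contMDiffAt_extChartAt' (by simpa [chartDom] using hy)

lemma contMDiffAt_iff_comp_symm {x₀ y : M} (hy : y ∈ chartDom x₀) {f : M → F} {n : ℕ∞} :
    ContMDiffAt (𝓡 3) 𝓘(ℝ, F) n f y ↔
      ContDiffAt ℝ n (f ∘ (extChartAt (𝓡 3) x₀).symm) (extChartAt (𝓡 3) x₀ y) := by
  have hn : (n : ℕ∞ω) ≤ ∞ := by exact_mod_cast le_top
  have hl := (extChartAt (𝓡 3) x₀).left_inv hy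
  rw [← contMDiffAt_iff_contDiffAt]
  constructor
  · intro h
    exact ContMDiffAt.comp _ (by rwa [hl]) ((contMDiffAt_extChartAt_symm hy).of_le hn)
  · intro h
    exact (ContMDiffAt.comp y h ((contMDiffAt_chart hy).of_le hn)).congr_of_eventuallyEq
      (eventuallyEq_comp_symm_comp hy f).symm

lemma mdifferentiableAt_iff_comp_symm {x₀ y : M} (hy : y ∈ chartDom x₀) {f : M → F} :
    MDifferentiableAt (𝓡 3) 𝓘(ℝ, F) f y ↔
      DifferentiableAt ℝ (f ∘ (extChartAt (𝓡 3) x₀).symm) (extChartAt (𝓡 3) x₀ y) := by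
  have hl := (extChartAt (𝓡 3) x₀).left_inv hy
  rw [← mdifferentiableAt_iff_differentiableAt]
  constructor
  · intro h
    exact MDifferentiableAt.comp _ (by rwa [hl])
      ((contMDiffAt_extChartAt_symm hy).mdifferentiableAt (by simp))
  · intro h
    exact (MDifferentiableAt.comp y h ((contMDiffAt_chart hy).mdifferentiableAt
      (by simp))).congr_of_eventuallyEq (eventuallyEq_comp_symm_comp hy f).symm

/-- The differential of a function on `M`, computed in a chart. -/
lemma mvfderiv_eq_fderiv {x₀ y : M} (hy : y ∈ chartDom x₀) {f : M → F}
    (hf : MDifferentiableAt (𝓡 3) 𝓘(ℝ, F) f y) (u : TangentSpace (𝓡 3) y) :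
    mvfderiv (𝓡 3) f y u =
      fderiv ℝ (f ∘ (extChartAt (𝓡 3) x₀).symm) (extChartAt (𝓡 3) x₀ y) (toChart x₀ y u) := by
  have h1 := (mdifferentiableAt_iff_comp_symm hy).1 hf
  have h2 : mfderiv (𝓡 3) 𝓘(ℝ, F) f y =
      mfderiv (𝓡 3) 𝓘(ℝ, F) ((f ∘ (extChartAt (𝓡 3) x₀).symm) ∘ extChartAt (𝓡 3) x₀) y :=
    ((eventuallyEq_comp_symm_comp hy f).mfderiv_eq).symm
  have h3 := mfderiv_comp (I'' := 𝓘(ℝ, F)) y h1.mdifferentiableAt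
    ((contMDiffAt_chart hy).mdifferentiableAt (by simp))
  rw [toChart_eq_mfderiv hy]
  change mfderiv (𝓡 3) 𝓘(ℝ, F) f y u = _
  rw [h2, h3, mfderiv_eq_fderiv]
  rfl

end Functions

lemma section_snd_eventuallyEq {x₀ y : M} (hy : y ∈ chartDom x₀)
    (Z : Π y : M, TangentSpace (𝓡 3) y) :
    (fun z ↦ (trivializationAt R3 (TangentSpace (𝓡 3)) x₀ ⟨z, Z z⟩).2) =ᶠ[𝓝 y]
      fun z ↦ toChart x₀ z (Z z) := by
  filter_upwards [chartDom_mem_nhds hy] with z hz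
  rw [toChart_eq_snd hz]

lemma contMDiffAt_field_iff {x₀ y : M} (hy : y ∈ chartDom x₀) {n : ℕ∞}
    {Z : Π y : M, TangentSpace (𝓡 3) y} :
    ContMDiffAt (𝓡 3) (𝓡 3).tangent n
      (fun x ↦ (TotalSpace.mk' R3 x (Z x) : TangentBundle (𝓡 3) M)) y ↔
    ContDiffAt ℝ n (chartRep x₀ Z) (extChartAt (𝓡 3) x₀ y) := by
  have : ContMDiffVectorBundle n R3 (TangentSpace (𝓡 3) : M → Type) (𝓡 3) :=
    .of_le (n := ∞) (by exact_mod_cast le_top)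
  refine ((trivializationAt R3 (TangentSpace (𝓡 3)) x₀).contMDiffAt_section_iff (n := n) (IB := 𝓡 3)
    (mem_baseSet_of_mem_chartDom hy)).trans ?_
  rw [(section_snd_eventuallyEq hy Z).contMDiffAt_iff, contMDiffAt_iff_comp_symm hy]
  rfl

lemma mdifferentiableAt_field_iff {x₀ y : M} (hy : y ∈ chartDom x₀)
    {Z : Π y : M, TangentSpace (𝓡 3) y} :
    MDifferentiableAt (𝓡 3) (𝓡 3).tangent
      (fun x ↦ (TotalSpace.mk' R3 x (Z x) : TangentBundle (𝓡 3) M)) y ↔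
    DifferentiableAt ℝ (chartRep x₀ Z) (extChartAt (𝓡 3) x₀ y) := by
  have : ContMDiffVectorBundle 1 R3 (TangentSpace (𝓡 3) : M → Type) (𝓡 3) :=
    .of_le (n := ∞) (by simp)
  refine ((trivializationAt R3 (TangentSpace (𝓡 3)) x₀).mdifferentiableAt_section_iff (𝓡 3)
    Z (mem_baseSet_of_mem_chartDom hy)).trans ?_
  have : MDifferentiableAt (𝓡 3) 𝓘(ℝ, R3) (fun z ↦ toChart x₀ z (Z z)) y ↔ _ :=
    mdifferentiableAt_iff_comp_symm hy
  rw [(section_snd_eventuallyEq hy Z).mdifferentiableAt_iff, this]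
  rfl

lemma chartRep_coordField_eventuallyEq {x₀ y : M} (hy : y ∈ chartDom x₀) (v : R3) :
    chartRep x₀ (coordField x₀ v) =ᶠ[𝓝 (extChartAt (𝓡 3) x₀ y)] fun _ ↦ v := by
  filter_upwards [extChartAt_target_mem_nhds' ((extChartAt (𝓡 3) x₀).map_source hy)] with p hp
  exact toChart_fromChart ((extChartAt (𝓡 3) x₀).map_target hp) v

lemma contMDiffAt_coordField {x₀ y : M} (hy : y ∈ chartDom x₀) (v : R3) :
    ContMDiffAt (𝓡 3) (𝓡 3).tangent ∞
      (fun x ↦ (TotalSpace.mk' R3 x (coordField x₀ v x) : TangentBundle (𝓡 3) M)) y :=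
  (contMDiffAt_field_iff (n := ⊤) hy).2
    (contDiffAt_const.congr_of_eventuallyEq (chartRep_coordField_eventuallyEq hy v))

lemma mdifferentiableAt_coordField {x₀ y : M} (hy : y ∈ chartDom x₀) (v : R3) :
    MDifferentiableAt (𝓡 3) (𝓡 3).tangent
      (fun x ↦ (TotalSpace.mk' R3 x (coordField x₀ v x) : TangentBundle (𝓡 3) M)) y :=
  (contMDiffAt_coordField hy v).mdifferentiableAt (by simp)

/-- A coordinate vector field agrees near any point of the chart with a smooth vector field
defined on all of `M`. -/
lemma exists_global_eventuallyEq_coordField [T2Space M] {x₀ y : M} (hy : y ∈ chartDom x₀)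
    (v : R3) : ∃ Z : Π y : M, TangentSpace (𝓡 3) y,
      ContMDiff (𝓡 3) (𝓡 3).tangent ∞
        (fun x ↦ (TotalSpace.mk' R3 x (Z x) : TangentBundle (𝓡 3) M)) ∧
      ∀ᶠ z in 𝓝 y, Z z = coordField x₀ v z := by
  obtain ⟨f, -, hf⟩ := ((SmoothBumpFunction.nhds_basis_tsupport (I := 𝓡 3) y).mem_iff).1
    (chartDom_mem_nhds hy)
  refine ⟨(f : M → ℝ) • coordField x₀ v, ?_, ?_⟩
  · exact ContMDiffOn.smul_section_of_tsupport f.contMDiff.contMDiffOn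
      (isOpen_extChartAt_source x₀) hf
      fun z hz ↦ (contMDiffAt_coordField hz v).contMDiffWithinAt
  · filter_upwards [f.eventuallyEq_one] with z hz
    simp [hz]

end Chart

/-! ### Christoffel symbols -/

section Christoffel

variable {M : Type*} [TopologicalSpace M] [ChartedSpace R3 M] [IsManifold (𝓡 3) ∞ M]

/-- The Christoffel symbols of a connection in the chart at `x₀`: the value
`christoffel cov x₀ p v u` represents `∇_u` of the coordinate field with components `v`. -/
def christoffel (cov : AffineConnection M) (x₀ : M) (p : R3) : R3 →L[ℝ] R3 →L[ℝ] R3 :=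
  ∑ i : Fin 3, (EuclideanSpace.proj i : R3 →L[ℝ] ℝ).smulRight
    (toChart x₀ ((extChartAt (𝓡 3) x₀).symm p) ∘L
      cov (coordField x₀ (EuclideanSpace.single i 1)) ((extChartAt (𝓡 3) x₀).symm p) ∘L
      fromChart x₀ ((extChartAt (𝓡 3) x₀).symm p))

lemma cov_sum_smul (cov : AffineConnection M) {ι : Type*} (s : Finset ι)
    (f : ι → M → ℝ) (E : ι → Π y : M, TangentSpace (𝓡 3) y) (y : M)
    (hf : ∀ i, MDifferentiableAt (𝓡 3) 𝓘(ℝ) (f i) y)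
    (hE : ∀ i, MDifferentiableAt (𝓡 3) (𝓡 3).tangent
      (fun x ↦ (TotalSpace.mk' R3 x (E i x) : TangentBundle (𝓡 3) M)) y) :
    cov (∑ i ∈ s, f i • E i) y =
      ∑ i ∈ s, (f i y • cov (E i) y + (mvfderiv (𝓡 3) (f i) y).smulRight (E i y)) := by
  classical
  have : ContMDiffVectorBundle 1 R3 (TangentSpace (𝓡 3) : M → Type) (𝓡 3) :=
    .of_le (n := ∞) (by simp)
  induction s using Finset.induction_on with
  | empty => simp
  | insert i s hi ih =>
    rw [Finset.sum_insert hi, Finset.sum_insert hi, ← ih,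
      cov.isCovariantDerivativeOnUniv.add ((hf i).smul_section (hE i)),
      cov.isCovariantDerivativeOnUniv.leibniz (hE i) (hf i)]
    have := MDifferentiableAt.sum_section (s := s) (t := fun i ↦ f i • E i)
      (fun i _ ↦ (hf i).smul_section (hE i))
    convert this using 3
    simp

lemma cov_congr (cov : AffineConnection M) {Z Z' : Π y : M, TangentSpace (𝓡 3) y} {y : M}
    (hZ : MDifferentiableAt (𝓡 3) (𝓡 3).tangent
      (fun x ↦ (TotalSpace.mk' R3 x (Z x) : TangentBundle (𝓡 3) M)) y)
    (h : ∀ᶠ z in 𝓝 y, Z z = Z' z) : cov Z y = cov Z' y := by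
  have hZ' : MDifferentiableAt (𝓡 3) (𝓡 3).tangent
      (fun x ↦ (TotalSpace.mk' R3 x (Z' x) : TangentBundle (𝓡 3) M)) y :=
    hZ.congr_of_eventuallyEq (by filter_upwards [h] with z hz; rw [hz])
  exact cov.isCovariantDerivativeOnUniv.congr_of_eventuallyEq hZ hZ' Filter.univ_mem h

/-- The covariant derivative in a chart: `∇_u Z = dZ(u) + Γ(Z, u)`. -/
lemma toChart_cov (cov : AffineConnection M) {x₀ y : M} (hy : y ∈ chartDom x₀)
    {Z : Π y : M, TangentSpace (𝓡 3) y}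
    (hZ : MDifferentiableAt (𝓡 3) (𝓡 3).tangent
      (fun x ↦ (TotalSpace.mk' R3 x (Z x) : TangentBundle (𝓡 3) M)) y)
    (u : TangentSpace (𝓡 3) y) :
    toChart x₀ y (cov Z y u) =
      fderiv ℝ (chartRep x₀ Z) (extChartAt (𝓡 3) x₀ y) (toChart x₀ y u) +
      christoffel cov x₀ (extChartAt (𝓡 3) x₀ y) (toChart x₀ y (Z y)) (toChart x₀ y u) := by
  set f : Fin 3 → M → ℝ := fun i z ↦ toChart x₀ z (Z z) i with hf
  set E : Fin 3 → Π y : M, TangentSpace (𝓡 3) y :=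
    fun i ↦ coordField x₀ (EuclideanSpace.single i 1) with hE
  have hZd := (mdifferentiableAt_field_iff hy).1 hZ
  have hrep (i : Fin 3) : (f i ∘ (extChartAt (𝓡 3) x₀).symm) =
    (EuclideanSpace.proj i : R3 →L[ℝ] ℝ) ∘ chartRep x₀ Z := rfl
  have hfd (i : Fin 3) : MDifferentiableAt (𝓡 3) 𝓘(ℝ) (f i) y := by
    rw [mdifferentiableAt_iff_comp_symm hy, hrep]
    exact (EuclideanSpace.proj i : R3 →L[ℝ] ℝ).differentiableAt.comp _ hZd
  have hsum (w : R3) : ∑ i : Fin 3, w i • (EuclideanSpace.single i (1 : ℝ) : R3) = w := by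
    ext j
    fin_cases j <;> simp [Fin.sum_univ_three]
  have hZE : ∀ᶠ z in 𝓝 y, Z z = (∑ i, f i • E i) z := by
    filter_upwards [chartDom_mem_nhds hy] with z hz
    rw [Finset.sum_apply]
    simp only [Pi.smul_apply', hE, hf, coordField]
    simp only [← map_smul, ← map_sum]
    rw [hsum, fromChart_toChart hz]
  rw [cov_congr cov hZ hZE, cov_sum_smul cov _ f E y hfd
    fun i ↦ mdifferentiableAt_coordField hy _]
  have hderiv (i : Fin 3) : mvfderiv (𝓡 3) (f i) y u =
      fderiv ℝ (chartRep x₀ Z) (extChartAt (𝓡 3) x₀ y) (toChart x₀ y u) i := by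
    rw [mvfderiv_eq_fderiv hy (hfd i), hrep,
      fderiv_comp _ (EuclideanSpace.proj i : R3 →L[ℝ] ℝ).differentiableAt hZd,
      ContinuousLinearMap.fderiv]
    rfl
  simp only [sum_apply, add_apply,
    smul_apply, ContinuousLinearMap.smulRight_apply, map_sum, map_add,
    map_smul, Finset.sum_add_distrib, hderiv, christoffel]
  rw [add_comm]
  congr 1
  · simp only [hE, coordField, toChart_fromChart hy]
    exact hsum _
  · rw [(extChartAt (𝓡 3) x₀).left_inv hy]
    simp [fromChart_toChart hy, hf, hE]

lemma toChart_cov_coordField (cov : AffineConnection M) {x₀ y : M} (hy : y ∈ chartDom x₀)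
    (v : R3) (u : TangentSpace (𝓡 3) y) :
    toChart x₀ y (cov (coordField x₀ v) y u) =
      christoffel cov x₀ (extChartAt (𝓡 3) x₀ y) v (toChart x₀ y u) := by
  rw [toChart_cov cov hy (mdifferentiableAt_coordField hy v),
    (chartRep_coordField_eventuallyEq hy v).fderiv_eq, coordField, toChart_fromChart hy]
  simp

/-- The Christoffel symbols of a smooth connection are smooth. -/
lemma contDiffAt_christoffel [T2Space M] {cov : AffineConnection M}
    (hcov : cov.ContMDiffCovariantDerivative ∞) {x₀ y : M} (hy : y ∈ chartDom x₀) :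
    ContDiffAt ℝ ∞ (christoffel cov x₀) (extChartAt (𝓡 3) x₀ y) := by
  unfold christoffel
  refine ContDiffAt.sum fun i _ ↦ ?_
  suffices h : ContDiffAt ℝ ∞ ((fun z ↦ (toChart x₀ z ∘L
      cov (coordField x₀ (EuclideanSpace.single i 1)) z ∘L fromChart x₀ z : R3 →L[ℝ] R3)) ∘
        (extChartAt (𝓡 3) x₀).symm) (extChartAt (𝓡 3) x₀ y) from
    contDiffAt_const.smulRight h
  obtain ⟨Z, hZ, hZE⟩ := exists_global_eventuallyEq_coordField hy (EuclideanSpace.single i 1)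
  have h1 := hcov.contMDiff.contMDiff (σ := Z) (by exact hZ.contMDiffOn)
  have h2 := h1.contMDiffAt (x := y) Filter.univ_mem
  have hmem := mem_baseSet_of_mem_chartDom hy
  rw [(trivializationAt (R3 →L[ℝ] R3)
    (fun x : M ↦ TangentSpace (𝓡 3) x →L[ℝ] TangentSpace (𝓡 3) x) x₀).contMDiffAt_section_iff
    (by simpa using hmem)] at h2
  refine (contMDiffAt_iff_comp_symm (n := ⊤) hy).1 (h2.congr_of_eventuallyEq ?_)
  filter_upwards [hZE.eventually_nhds] with z hz
  rw [← cov_congr cov (hZ.mdifferentiable (by simp) z) hz]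
  rfl

end Christoffel

/-! ### Torsion, metric and volume form in a chart -/

section TensorsInChart

variable {M : Type*} [TopologicalSpace M] [ChartedSpace R3 M] [IsManifold (𝓡 3) ∞ M]

/-- A constant vector field on the model space. -/
def constField (v : R3) (p : R3) : TangentSpace 𝓘(ℝ, R3) p := v

lemma mlieBracket_constField (v w p : R3) :
    VectorField.mlieBracket 𝓘(ℝ, R3) (constField v) (constField w) p = 0 := by
  rw [← VectorField.mlieBracketWithin_univ, VectorField.mlieBracketWithin_eq_lieBracketWithin]
  have h (u : R3) : fderivWithin ℝ (constField u : R3 → R3) Set.univ p = 0 :=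
    congrFun (fderivWithin_const u) p
  change fderivWithin ℝ (constField w : R3 → R3) Set.univ p _ -
    fderivWithin ℝ (constField v : R3 → R3) Set.univ p _ = 0
  rw [h, h]
  exact sub_self (0 : R3)

lemma mlieBracket_coordField {x₀ y : M} (hy : y ∈ chartDom x₀) (v w : R3) :
    VectorField.mlieBracket (𝓡 3) (coordField x₀ v) (coordField x₀ w) y = 0 := by
  have : IsManifold (𝓡 3) (minSmoothness ℝ 3) M := .of_le (n := ∞) (by
    rw [minSmoothness_of_isRCLikeNormedField]; exact ENat.LEInfty.out)
  have hpull (v : R3) : VectorField.mpullback (𝓡 3) 𝓘(ℝ, R3) (extChartAt (𝓡 3) x₀)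
      (constField v) =ᶠ[𝓝 y] coordField x₀ v := by
    filter_upwards [chartDom_mem_nhds hy] with z hz
    rw [VectorField.mpullback_apply, ← toChart_eq_mfderiv hz]
    let e : TangentSpace (𝓡 3) z ≃L[ℝ] R3 := ContinuousLinearEquiv.equivOfInverse
      (toChart x₀ z) (fromChart x₀ z) (fromChart_toChart hz) (toChart_fromChart hz)
    change ((e : TangentSpace (𝓡 3) z →L[ℝ] R3).inverse) v = e.symm v
    rw [ContinuousLinearMap.inverse_equiv]
    rfl
  have hconst (v : R3) : MDifferentiableAt 𝓘(ℝ, R3) 𝓘(ℝ, R3).tangent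
      (fun p : R3 ↦ (TotalSpace.mk' R3 p (constField v p) : TangentBundle 𝓘(ℝ, R3) R3))
      (extChartAt (𝓡 3) x₀ y) :=
    (contMDiffAt_vectorSpace_iff_contDiffAt (V := constField v) (n := 1)).2
      contDiffAt_const |>.mdifferentiableAt (by simp)
  rw [← (hpull v).mlieBracket_vectorField_eq (hpull w),
    ← VectorField.mpullback_mlieBracket (hconst v) (hconst w) (contMDiffAt_chart hy)
      (by rw [minSmoothness_of_isRCLikeNormedField]; exact ENat.LEInfty.out),
    VectorField.mpullback_apply, mlieBracket_constField, map_zero]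

lemma christoffel_symm {cov : AffineConnection M} (h : cov.torsion = 0) {x₀ y : M}
    (hy : y ∈ chartDom x₀) (v w : R3) :
    christoffel cov x₀ (extChartAt (𝓡 3) x₀ y) v w =
      christoffel cov x₀ (extChartAt (𝓡 3) x₀ y) w v := by
  have h1 := cov.torsion_eq_zero_iff.1 h (mdifferentiableAt_coordField hy v)
    (mdifferentiableAt_coordField hy w)
  rw [mlieBracket_coordField hy, sub_eq_zero] at h1
  have h2 := congrArg (toChart x₀ y) h1
  rw [toChart_cov_coordField cov hy, toChart_cov_coordField cov hy, coordField, coordField,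
    toChart_fromChart hy, toChart_fromChart hy] at h2
  exact h2.symm

/-- The components of a covariant 2-tensor in the chart at `x₀`. -/
def tensorRep (T : SymTwoTensor M) (x₀ : M) (p : R3) : R3 →L[ℝ] R3 →L[ℝ] ℝ :=
  (trivializationAt (R3 →L[ℝ] R3 →L[ℝ] ℝ)
    (fun x : M ↦ TangentSpace (𝓡 3) x →L[ℝ] TangentSpace (𝓡 3) x →L[ℝ] ℝ) x₀
    ⟨(extChartAt (𝓡 3) x₀).symm p, T.toFun ((extChartAt (𝓡 3) x₀).symm p)⟩).2

lemma tensor_trivialization_apply {x₀ y : M} (hy : y ∈ chartDom x₀)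
    (B : TangentSpace (𝓡 3) y →L[ℝ] TangentSpace (𝓡 3) y →L[ℝ] ℝ) (v w : R3) :
    (trivializationAt (R3 →L[ℝ] R3 →L[ℝ] ℝ)
      (fun x : M ↦ TangentSpace (𝓡 3) x →L[ℝ] TangentSpace (𝓡 3) x →L[ℝ] ℝ) x₀ ⟨y, B⟩).2 v w =
    B (coordField x₀ v y) (coordField x₀ w y) := by
  have hmem := mem_baseSet_of_mem_chartDom hy
  rw [hom_trivializationAt_apply]
  dsimp only
  rw [inCoordinates_apply_eq₂ hmem hmem (by simp)]
  simp [coordField, fromChart, Trivialization.symmL_apply _ hmem]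

lemma tensorRep_apply (T : SymTwoTensor M) {x₀ y : M} (hy : y ∈ chartDom x₀) (v w : R3) :
    tensorRep T x₀ (extChartAt (𝓡 3) x₀ y) v w =
      T.toFun y (coordField x₀ v y) (coordField x₀ w y) := by
  rw [tensorRep, (extChartAt (𝓡 3) x₀).left_inv hy, tensor_trivialization_apply hy]

set_option synthInstance.maxHeartbeats 200000 in
lemma contDiffAt_tensorRep (T : SymTwoTensor M) {x₀ y : M} (hy : y ∈ chartDom x₀) :
    ContDiffAt ℝ ∞ (tensorRep T x₀) (extChartAt (𝓡 3) x₀ y) := by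
  have h := T.contMDiff y
  have hmem := mem_baseSet_of_mem_chartDom hy
  rw [(trivializationAt (R3 →L[ℝ] R3 →L[ℝ] ℝ) (fun x : M ↦ TangentSpace (𝓡 3) x →L[ℝ]
    TangentSpace (𝓡 3) x →L[ℝ] ℝ) x₀).contMDiffAt_section_iff (by simpa using hmem)] at h
  exact (contMDiffAt_iff_comp_symm (n := ⊤) hy).1 h

/-- Metric compatibility in a chart: `∂_a g(v, w) = g(Γ(v, a), w) + g(v, Γ(w, a))`. -/
lemma fderiv_tensorRep {D : AffineConnection M} {g : MetricTensor M} (h : IsLeviCivita D g)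
    {x₀ y : M} (hy : y ∈ chartDom x₀) (a v w : R3) :
    fderiv ℝ (tensorRep g.toSymTwoTensor x₀) (extChartAt (𝓡 3) x₀ y) a v w =
      tensorRep g.toSymTwoTensor x₀ (extChartAt (𝓡 3) x₀ y)
        (christoffel D x₀ (extChartAt (𝓡 3) x₀ y) v a) w +
      tensorRep g.toSymTwoTensor x₀ (extChartAt (𝓡 3) x₀ y) v
        (christoffel D x₀ (extChartAt (𝓡 3) x₀ y) w a) := by
  have hd : DifferentiableAt ℝ (tensorRep g.toSymTwoTensor x₀) (extChartAt (𝓡 3) x₀ y) :=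
    (contDiffAt_tensorRep _ hy).differentiableAt (by simp)
  have hm := h.metric y (coordField x₀ a y) _ _ (mdifferentiableAt_coordField hy v)
    (mdifferentiableAt_coordField hy w)
  set f : M → ℝ := fun z ↦ g.toFun z (coordField x₀ v z) (coordField x₀ w z) with hf
  have hrep : f ∘ (extChartAt (𝓡 3) x₀).symm =ᶠ[𝓝 (extChartAt (𝓡 3) x₀ y)]
      fun p ↦ tensorRep g.toSymTwoTensor x₀ p v w := by
    filter_upwards [extChartAt_target_mem_nhds' ((extChartAt (𝓡 3) x₀).map_source hy)] with p hp
    exact (tensor_trivialization_apply ((extChartAt (𝓡 3) x₀).map_target hp) _ v w).symm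
  have hfd : MDifferentiableAt (𝓡 3) 𝓘(ℝ) f y := by
    rw [mdifferentiableAt_iff_comp_symm hy, hrep.differentiableAt_iff]
    fun_prop
  rw [mvfderiv_eq_fderiv hy hfd, hrep.fderiv_eq] at hm
  have e1 : fderiv ℝ (fun p ↦ tensorRep g.toSymTwoTensor x₀ p v w) (extChartAt (𝓡 3) x₀ y) a =
      fderiv ℝ (tensorRep g.toSymTwoTensor x₀) (extChartAt (𝓡 3) x₀ y) a v w := by
    have := ((hd.hasFDerivAt.clm_apply (hasFDerivAt_const v _)).clm_apply
      (hasFDerivAt_const w _)).fderiv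
    rw [this]
    simp
  rw [coordField, toChart_fromChart hy, e1] at hm
  rw [hm, tensorRep_apply _ hy, tensorRep_apply _ hy]
  simp only [coordField]
  have e2 (v : R3) : fromChart x₀ y (christoffel D x₀ (extChartAt (𝓡 3) x₀ y) v a) =
      D (coordField x₀ v) y (fromChart x₀ y a) := by
    rw [← fromChart_toChart hy (D (coordField x₀ v) y (fromChart x₀ y a)),
      toChart_cov_coordField D hy, toChart_fromChart hy]
  rw [e2, e2]

/-- The component of a volume form in the chart at `x₀`. -/
def volumeRep (ε : VolumeForm M) (x₀ : M) (p : R3) : ℝ :=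
  ε.toFun ((extChartAt (𝓡 3) x₀).symm p)
    fun i ↦ coordField x₀ (EuclideanSpace.single i 1) ((extChartAt (𝓡 3) x₀).symm p)

lemma contDiffAt_volumeRep [T2Space M] (ε : VolumeForm M) {x₀ y : M} (hy : y ∈ chartDom x₀) :
    ContDiffAt ℝ ∞ (volumeRep ε x₀) (extChartAt (𝓡 3) x₀ y) := by
  choose Z hZ hZE using fun i : Fin 3 ↦
    exists_global_eventuallyEq_coordField hy (EuclideanSpace.single i 1)
  refine (contMDiffAt_iff_comp_symm (n := ⊤) hy
    (f := fun z ↦ ε.toFun z fun i ↦ coordField x₀ (EuclideanSpace.single i 1) z)).1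
      ((ε.smooth Z hZ).contMDiffAt.congr_of_eventuallyEq ?_)
  filter_upwards [Filter.eventually_all.2 hZE] with z hz
  simp only [hz]

/-- An alternating form of top degree is scaled by the trace under a derivation. -/
lemma sum_alternating_update_eq_trace {V : Type*} [AddCommGroup V] [Module ℝ V]
    (f : V [⋀^Fin 3]→ₗ[ℝ] ℝ) (b : Fin 3 → V) (c : Fin 3 → Fin 3 → ℝ) :
    ∑ i, f (Function.update b i (∑ j, c i j • b j)) = (∑ i, c i i) * f b := by
  rw [Finset.sum_mul]
  refine Finset.sum_congr rfl fun i _ ↦ ?_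
  rw [f.map_update_sum, Finset.sum_eq_single i]
  · rw [f.map_update_smul, Function.update_eq_self, smul_eq_mul]
  · intro j _ hj
    rw [f.map_update_smul, f.map_update_self _ hj.symm, smul_zero]
  · simp

lemma fderiv_volumeRep [T2Space M] {cov : AffineConnection M} {ε : VolumeForm M}
    (h : IsParallelVolume cov ε) {x₀ y : M} (hy : y ∈ chartDom x₀) (a : R3) :
    fderiv ℝ (volumeRep ε x₀) (extChartAt (𝓡 3) x₀ y) a =
      (∑ i, christoffel cov x₀ (extChartAt (𝓡 3) x₀ y) (EuclideanSpace.single i 1) a i) *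
        volumeRep ε x₀ (extChartAt (𝓡 3) x₀ y) := by
  have hm := h y (coordField x₀ a y) (fun i ↦ coordField x₀ (EuclideanSpace.single i 1))
    fun i ↦ mdifferentiableAt_coordField hy _
  set f : M → ℝ := fun z ↦ ε.toFun z fun i ↦ coordField x₀ (EuclideanSpace.single i 1) z with hf
  have hrep : f ∘ (extChartAt (𝓡 3) x₀).symm = volumeRep ε x₀ := rfl
  have hfd : MDifferentiableAt (𝓡 3) 𝓘(ℝ) f y := by
    rw [mdifferentiableAt_iff_comp_symm hy, hrep]
    exact (contDiffAt_volumeRep ε hy).differentiableAt (by simp)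
  rw [mvfderiv_eq_fderiv hy hfd, hrep, coordField, toChart_fromChart hy] at hm
  have e2 (v : R3) : cov (coordField x₀ v) y (fromChart x₀ y a) =
      ∑ j, christoffel cov x₀ (extChartAt (𝓡 3) x₀ y) v a j •
        coordField x₀ (EuclideanSpace.single j 1) y := by
    rw [← fromChart_toChart hy (cov (coordField x₀ v) y (fromChart x₀ y a)),
      toChart_cov_coordField cov hy, toChart_fromChart hy]
    simp only [coordField, ← map_smul, ← map_sum]
    congr 1
    ext j
    fin_cases j <;> simp [Fin.sum_univ_three]
  simp only [e2] at hm
  rw [hm, sum_alternating_update_eq_trace]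
  rw [volumeRep, (extChartAt (𝓡 3) x₀).left_inv hy]

lemma volumeRep_ne_zero (ε : VolumeForm M) {x₀ y : M} (hy : y ∈ chartDom x₀) :
    volumeRep ε x₀ (extChartAt (𝓡 3) x₀ y) ≠ 0 := by
  rw [volumeRep, (extChartAt (𝓡 3) x₀).left_inv hy]
  let e : R3 ≃ₗ[ℝ] TangentSpace (𝓡 3) y := LinearEquiv.ofLinearMap
    (fromChart x₀ y : R3 →ₗ[ℝ] TangentSpace (𝓡 3) y)
    (toChart x₀ y : TangentSpace (𝓡 3) y →ₗ[ℝ] R3)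
    (LinearMap.ext (fromChart_toChart hy)) (LinearMap.ext (toChart_fromChart hy))
  intro h0
  refine ε.ne_zero y (Module.Basis.ext_alternating
    ((EuclideanSpace.basisFun (Fin 3) ℝ).toBasis.map e) fun v hv ↦ ?_)
  -- an injective `v` is a permutation of the three indices
  let σ : Equiv.Perm (Fin 3) := Equiv.ofBijective v (Finite.injective_iff_bijective.1 hv)
  have h1 := (ε.toFun y).map_perm
    (fun i ↦ coordField x₀ (EuclideanSpace.single i 1) y) σ
  rw [h0, smul_zero] at h1
  simpa [e, coordField, σ, Function.comp_def] using h1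

end TensorsInChart

/-! ### Geodesics and projective equivalence -/

section GeodesicEquation

/-- Local solutions of the geodesic equation with given initial point and velocity. -/
lemma exists_geodesic {U : Set R3} (hU : IsOpen U) {Γ : R3 → R3 →L[ℝ] R3 →L[ℝ] R3}
    (hΓ : ContDiffOn ℝ ∞ Γ U) {p : R3} (hp : p ∈ U) {v : R3} (hv : v ≠ 0) :
    ∃ δ > 0, ∃ c : ℝ → R3, ContDiffOn ℝ ∞ c (Set.Ioo (-δ) δ) ∧ c 0 = p ∧ deriv c 0 = v ∧
      ∀ t ∈ Set.Ioo (-δ) δ, c t ∈ U ∧ deriv c t ≠ 0 ∧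
        deriv (deriv c) t = -Γ (c t) (deriv c t) (deriv c t) := by
  set W : Set (R3 × R3) := U ×ˢ {0}ᶜ with hW
  have hWo : IsOpen W := hU.prod isOpen_compl_singleton
  set f : R3 × R3 → R3 × R3 := fun q ↦ (q.2, -Γ q.1 q.2 q.2) with hf
  have hfW : ContDiffOn ℝ ∞ f W := by
    have h1 : ContDiffOn ℝ ∞ (fun q : R3 × R3 ↦ Γ q.1) W :=
      hΓ.comp contDiffOn_fst fun q hq ↦ hq.1
    exact contDiffOn_snd.prodMk ((h1.clm_apply contDiffOn_snd).clm_apply contDiffOn_snd).neg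
  have hpv : (p, v) ∈ W := ⟨hp, hv⟩
  obtain ⟨α, hα0, δ, hδ, hα⟩ :=
    ContDiffAt.exists_forall_mem_closedBall_exists_eq_forall_mem_Ioo_hasDerivAt₀
      ((hfW.contDiffAt (hWo.mem_nhds hpv)).of_le (by simp)) 0
  simp only [zero_sub, zero_add] at hα
  have hαc : ContinuousAt α 0 := (hα 0 ⟨by linarith, hδ⟩).continuousAt
  have hmem : ∀ᶠ t in 𝓝 (0 : ℝ), α t ∈ W :=
    hαc.eventually (hWo.mem_nhds (by rw [hα0]; exact hpv))
  obtain ⟨δ', hδ', hball⟩ := Metric.eventually_nhds_iff_ball.1 hmem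
  -- a closed interval inside the one where the solution exists and stays in `W`
  set η := min δ δ' / 2 with hη
  have hη0 : 0 < η := by positivity
  have hηδ : η < δ := by have := min_le_left δ δ'; linarith
  have hηδ' : η < δ' := by have := min_le_right δ δ'; linarith
  have hsub : Set.Icc (-η) η ⊆ Set.Ioo (-δ) δ := fun t ht ↦
    ⟨by linarith [ht.1], by linarith [ht.2]⟩
  have hmaps : Set.MapsTo α (Set.Icc (-η) η) W := fun t ht ↦ hball t (by
    rw [Metric.mem_ball, Real.dist_eq, sub_zero, abs_lt]
    exact ⟨by linarith [ht.1], by linarith [ht.2]⟩)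
  have hsmooth : ContDiffOn ℝ ∞ α (Set.Icc (-η) η) :=
    ODE.contDiffOn_enat_Icc_of_hasDerivWithinAt (n := ⊤) (f := fun _ ↦ f) (u := W)
      (hfW.comp contDiffOn_snd fun q hq ↦ hq.2)
      (fun t ht ↦ (hα t (hsub ht)).hasDerivWithinAt) hmaps
  have hfst (t : ℝ) (ht : t ∈ Set.Ioo (-δ) δ) : HasDerivAt (fun s ↦ (α s).1) (α t).2 t :=
    (ContinuousLinearMap.fst ℝ R3 R3).hasFDerivAt.comp_hasDerivAt t (hα t ht)
  have hsnd (t : ℝ) (ht : t ∈ Set.Ioo (-δ) δ) :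
      HasDerivAt (fun s ↦ (α s).2) (-Γ (α t).1 (α t).2 (α t).2) t :=
    (ContinuousLinearMap.snd ℝ R3 R3).hasFDerivAt.comp_hasDerivAt t (hα t ht)
  refine ⟨η, hη0, fun s ↦ (α s).1, contDiff_fst.comp_contDiffOn
    (hsmooth.mono Set.Ioo_subset_Icc_self), by simp [hα0], ?_, fun t ht ↦ ?_⟩
  · rw [(hfst 0 ⟨by linarith, hδ⟩).deriv, hα0]
  · have ht' := hsub (Set.Ioo_subset_Icc_self ht)
    have hd : deriv (fun s ↦ (α s).1) =ᶠ[𝓝 t] fun s ↦ (α s).2 := by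
      filter_upwards [isOpen_Ioo.mem_nhds ht'] with s hs using (hfst s hs).deriv
    have hm := hmaps (Set.Ioo_subset_Icc_self ht)
    refine ⟨hm.1, ?_, ?_⟩
    · rw [(hfst t ht').deriv]; exact hm.2
    · rw [hd.deriv_eq, (hsnd t ht').deriv, (hfst t ht').deriv]

/-- The velocity of a regular curve extends locally to a smooth vector field. -/
lemma exists_extension_deriv {c : ℝ → R3} {t : ℝ} (hc : ContDiffAt ℝ ∞ c t)
    (hc' : ContDiffAt ℝ ∞ (deriv c) t) (h0 : deriv c t ≠ 0) :
    ∃ X : R3 → R3, ContDiffAt ℝ ∞ X (c t) ∧ ∀ᶠ s in 𝓝 t, X (c s) = deriv c s := by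
  -- a linear function that is not stationary along the curve at time `t` recovers the parameter
  set l : R3 →L[ℝ] ℝ := innerSL ℝ (deriv c t) with hl
  have hh : ContDiffAt ℝ ∞ (fun s ↦ l (c s)) t := l.contDiff.contDiffAt.comp t hc
  have hd : HasDerivAt (fun s ↦ l (c s)) (l (deriv c t)) t :=
    l.hasFDerivAt.comp_hasDerivAt t (hc.differentiableAt (by simp)).hasDerivAt
  have hne : l (deriv c t) ≠ 0 := by simpa [hl] using h0
  let e : ℝ ≃L[ℝ] ℝ := ContinuousLinearEquiv.unitsEquivAut ℝ (Units.mk0 _ hne)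
  have hde : HasFDerivAt (fun s ↦ l (c s)) (e : ℝ →L[ℝ] ℝ) t := by
    have he : (e : ℝ →L[ℝ] ℝ) = ContinuousLinearMap.toSpanSingleton ℝ (l (deriv c t)) := by
      ext
      simp [e]
    rw [he]
    exact hd.hasFDerivAt
  let k := hh.localInverse hde (by simp)
  have hk : ContDiffAt ℝ ∞ k (l (c t)) := hh.to_localInverse hde (by simp)
  have hleft : ∀ᶠ s in 𝓝 t, k (l (c s)) = s :=
    (hh.hasStrictFDerivAt' hde (by simp)).eventually_left_inverse
  have hkt : k (l (c t)) = t := hleft.self_of_nhds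
  refine ⟨fun q ↦ deriv c (k (l q)), ?_, ?_⟩
  · refine ContDiffAt.comp (g := deriv c) (f := fun q ↦ k (l q)) (c t)
      (by simpa only [hkt] using hc') ?_
    exact ContDiffAt.comp (c t) hk l.contDiff.contDiffAt
  · filter_upwards [hleft] with s hs
    rw [hs]

end GeodesicEquation

section GeodesicInChart

variable {M : Type*} [TopologicalSpace M] [ChartedSpace R3 M] [IsManifold (𝓡 3) ∞ M]

lemma toChart_velocity {x₀ : M} {c : ℝ → R3} {t : ℝ} (hc : DifferentiableAt ℝ c t)
    (ht : ∀ᶠ s in 𝓝 t, c s ∈ (extChartAt (𝓡 3) x₀).target) :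
    toChart x₀ ((extChartAt (𝓡 3) x₀).symm (c t))
      (velocity (fun s ↦ (extChartAt (𝓡 3) x₀).symm (c s)) t) = deriv c t := by
  have hmem := (extChartAt (𝓡 3) x₀).map_target ht.self_of_nhds
  have hsymm := contMDiffAt_extChartAt_symm hmem
  rw [(extChartAt (𝓡 3) x₀).right_inv ht.self_of_nhds] at hsymm
  have hγ : MDifferentiableAt 𝓘(ℝ) (𝓡 3) (fun s ↦ (extChartAt (𝓡 3) x₀).symm (c s)) t :=
    MDifferentiableAt.comp t (hsymm.mdifferentiableAt (by simp)) hc.mdifferentiableAt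
  have hcomp := mfderiv_comp t ((contMDiffAt_chart hmem).mdifferentiableAt (by simp)) hγ
  have heq : extChartAt (𝓡 3) x₀ ∘ (fun s ↦ (extChartAt (𝓡 3) x₀).symm (c s)) =ᶠ[𝓝 t] c := by
    filter_upwards [ht] with s hs using (extChartAt (𝓡 3) x₀).right_inv hs
  rw [heq.mfderiv_eq, mfderiv_eq_fderiv] at hcomp
  rw [toChart_eq_mfderiv hmem, velocity]
  exact (congrArg (fun L : ℝ →L[ℝ] R3 ↦ L 1) hcomp).symm

/-- The acceleration of a curve in a chart: `c'' + Γ(c', c')`. -/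
lemma toChart_acceleration {cov : AffineConnection M} {x₀ : M} {c : ℝ → R3} {t : ℝ}
    (hc : ∀ᶠ s in 𝓝 t, DifferentiableAt ℝ c s)
    (ht : ∀ᶠ s in 𝓝 t, c s ∈ (extChartAt (𝓡 3) x₀).target)
    {a : TangentSpace (𝓡 3) ((extChartAt (𝓡 3) x₀).symm (c t))}
    (h : HasAcceleration cov (fun s ↦ (extChartAt (𝓡 3) x₀).symm (c s)) t a) :
    toChart x₀ ((extChartAt (𝓡 3) x₀).symm (c t)) a =
      deriv (deriv c) t + christoffel cov x₀ (c t) (deriv c t) (deriv c t) := by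
  obtain ⟨X, hX, hXc, rfl⟩ := h
  have htt := ht.self_of_nhds
  have hmem := (extChartAt (𝓡 3) x₀).map_target htt
  have hXm := hX.mdifferentiableAt (by simp)
  have hXd := (mdifferentiableAt_field_iff hmem).1 hXm
  rw [(extChartAt (𝓡 3) x₀).right_inv htt] at hXd
  rw [toChart_cov cov hmem hXm, hXc.self_of_nhds,
    toChart_velocity hc.self_of_nhds ht, (extChartAt (𝓡 3) x₀).right_inv htt]
  congr 1
  have heq : (fun s ↦ chartRep x₀ X (c s)) =ᶠ[𝓝 t] deriv c := by
    filter_upwards [hXc, hc.eventually_nhds, ht.eventually_nhds] with s h1 h2 h3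
    rw [chartRep, h1, toChart_velocity h2.self_of_nhds h3]
  rw [← heq.deriv_eq]
  exact (hXd.hasFDerivAt.comp_hasDerivAt t hc.self_of_nhds.hasDerivAt).deriv.symm

/-- The Christoffel symbols of projectively equivalent connections differ, on each vector, by a
multiple of that vector: follow a geodesic of one connection in that direction. -/
lemma exists_christoffel_sub_eq_smul [T2Space M] {D cov : AffineConnection M}
    (hD : D.ContMDiffCovariantDerivative ∞) (h : ProjectivelyEquivalent D cov)
    {x₀ y : M} (hy : y ∈ chartDom x₀) (v : R3) :
    ∃ k : ℝ, christoffel cov x₀ (extChartAt (𝓡 3) x₀ y) v v -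
      christoffel D x₀ (extChartAt (𝓡 3) x₀ y) v v = k • v := by
  by_cases hv : v = 0
  · exact ⟨0, by simp [hv]⟩
  set φ := extChartAt (𝓡 3) x₀ with hφ
  have hΓ : ContDiffOn ℝ ∞ (christoffel D x₀) φ.target := fun p hp ↦ by
    have := contDiffAt_christoffel hD (φ.map_target hp)
    rw [φ.right_inv hp] at this
    exact this.contDiffWithinAt
  obtain ⟨δ, hδ, c, hcs, hc0, hcv, hc⟩ := exists_geodesic (isOpen_extChartAt_target x₀) hΓ
    (φ.map_source hy) hv
  have hcat {t : ℝ} (ht : t ∈ Set.Ioo (-δ) δ) : ContDiffAt ℝ ∞ c t :=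
    hcs.contDiffAt (isOpen_Ioo.mem_nhds ht)
  have hcd {t : ℝ} (ht : t ∈ Set.Ioo (-δ) δ) : ∀ᶠ s in 𝓝 t, DifferentiableAt ℝ c s := by
    filter_upwards [isOpen_Ioo.mem_nhds ht] with s hs using (hcat hs).differentiableAt (by simp)
  have hct {t : ℝ} (ht : t ∈ Set.Ioo (-δ) δ) : ∀ᶠ s in 𝓝 t, c s ∈ φ.target := by
    filter_upwards [isOpen_Ioo.mem_nhds ht] with s hs using (hc s hs).1
  set γ : ℝ → M := fun s ↦ φ.symm (c s) with hγ
  have hgeo : IsUnparamGeodesicOn D γ (Set.Ioo (-δ) δ) := by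
    refine ⟨?_, fun t ht h0 ↦ ?_, fun t ht ↦ ⟨0, ?_⟩⟩
    · exact (contMDiffOn_extChartAt_symm x₀).comp hcs.contMDiffOn fun t ht ↦ (hc t ht).1
    · refine (hc t ht).2.1 ?_
      rw [← toChart_velocity (hcd ht).self_of_nhds (hct ht)]
      exact (congrArg _ h0).trans (map_zero _)
    · have hmem : γ t ∈ chartDom x₀ := φ.map_target (hc t ht).1
      have hφγ : φ (γ t) = c t := φ.right_inv (hc t ht).1
      have hc2 : ContDiffAt ℝ ∞ (deriv c) t :=
        (hcs.deriv_of_isOpen isOpen_Ioo (by simp)).contDiffAt (isOpen_Ioo.mem_nhds ht)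
      obtain ⟨X, hXs, hX⟩ := exists_extension_deriv (hcat ht) hc2 (hc t ht).2.1
      set Z : Π y : M, TangentSpace (𝓡 3) y := fun y ↦ fromChart x₀ y (X (φ y)) with hZ
      have hacc : HasAcceleration D γ t (D Z (γ t) (velocity γ t)) := by
        refine ⟨Z, ?_, ?_, rfl⟩
        · refine (contMDiffAt_field_iff (n := ⊤) hmem).2 ?_
          rw [← hφ, hφγ]
          refine hXs.congr_of_eventuallyEq ?_
          filter_upwards [(isOpen_extChartAt_target x₀).mem_nhds (hc t ht).1] with q hq
          rw [chartRep, hZ, toChart_fromChart (φ.map_target hq), φ.right_inv hq]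
        · filter_upwards [hX, isOpen_Ioo.mem_nhds ht] with s hs hsI
          change fromChart x₀ (γ s) (X (φ (γ s))) = _
          rw [show φ (γ s) = c s from φ.right_inv (hc s hsI).1, hs,
            ← toChart_velocity (hcd hsI).self_of_nhds (hct hsI)]
          exact fromChart_toChart (φ.map_target (hc s hsI).1) _
      have ha := toChart_acceleration (hcd ht) (hct ht) hacc
      rw [(hc t ht).2.2, neg_add_cancel] at ha
      have hz : D Z (γ t) (velocity γ t) = 0 := by
        rw [← fromChart_toChart hmem (D Z (γ t) (velocity γ t))]
        exact (congrArg _ ha).trans (map_zero _)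
      rw [zero_smul, ← hz]
      exact hacc
  have h0 : (0 : ℝ) ∈ Set.Ioo (-δ) δ := ⟨by linarith, hδ⟩
  obtain ⟨k, hk⟩ := ((h γ _ isOpen_Ioo Set.ordConnected_Ioo).1 hgeo).accel 0 h0
  have hk2 := toChart_acceleration (hcd h0) (hct h0) hk
  rw [map_smul, toChart_velocity (hcd h0).self_of_nhds (hct h0), (hc 0 h0).2.2, hcv, hc0] at hk2
  exact ⟨k, by rw [hk2]; abel⟩

end GeodesicInChart

/-! ### Curvature of Christoffel symbols -/

section Curvature

variable {E : Type*} [NormedAddCommGroup E] [NormedSpace ℝ E]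

/-- The curvature `R(u, w)` at `p` of the connection on the model space with Christoffel symbols
`Γ p v u = ∇_u v`. -/
def christoffelCurvature (Γ : E → E →L[ℝ] E →L[ℝ] E) (p u w c : E) : E :=
  fderiv ℝ Γ p u c w - fderiv ℝ Γ p w c u + Γ p (Γ p c w) u - Γ p (Γ p c u) w

lemma christoffelCurvature_antisymm (Γ : E → E →L[ℝ] E →L[ℝ] E) (p u w c : E) :
    christoffelCurvature Γ p u w c = -christoffelCurvature Γ p w u c := by
  simp only [christoffelCurvature]; abel

variable {p : E}

lemma hasFDerivAt_apply₂ {F : Type*} [NormedAddCommGroup F] [NormedSpace ℝ F]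
    {Γ : E → E →L[ℝ] E →L[ℝ] F} (hΓ : DifferentiableAt ℝ Γ p) (v w : E) :
    HasFDerivAt (fun q ↦ Γ q v w) (((fderiv ℝ Γ p).flip v).flip w) p := by
  have := (hΓ.hasFDerivAt.clm_apply (hasFDerivAt_const v p)).clm_apply (hasFDerivAt_const w p)
  exact this.congr_fderiv (by ext a; simp)

lemma fderiv_apply₂ {F : Type*} [NormedAddCommGroup F] [NormedSpace ℝ F]
    {Γ : E → E →L[ℝ] E →L[ℝ] F} (hΓ : DifferentiableAt ℝ Γ p) (u v w : E) :
    fderiv ℝ (fun q ↦ Γ q v w) p u = fderiv ℝ Γ p u v w := by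
  rw [(hasFDerivAt_apply₂ hΓ v w).fderiv, ContinuousLinearMap.flip_apply,
    ContinuousLinearMap.flip_apply]

variable {Γ : E → E →L[ℝ] E →L[ℝ] E}

lemma fderiv_apply₂_symm (hΓ : DifferentiableAt ℝ Γ p)
    (hs : ∀ᶠ q in 𝓝 p, ∀ v w, Γ q v w = Γ q w v) (u v w : E) :
    fderiv ℝ Γ p u v w = fderiv ℝ Γ p u w v := by
  have h : (fun q ↦ Γ q v w) =ᶠ[𝓝 p] fun q ↦ Γ q w v := by
    filter_upwards [hs] with q hq using hq v w
  rw [← fderiv_apply₂ hΓ, ← fderiv_apply₂ hΓ, h.fderiv_eq]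

/-- The first Bianchi identity. -/
lemma christoffelCurvature_bianchi (hΓ : DifferentiableAt ℝ Γ p)
    (hs : ∀ᶠ q in 𝓝 p, ∀ v w, Γ q v w = Γ q w v) (u v w : E) :
    christoffelCurvature Γ p u v w + christoffelCurvature Γ p v w u +
      christoffelCurvature Γ p w u v = 0 := by
  have h0 := hs.self_of_nhds
  simp only [christoffelCurvature]
  rw [fderiv_apply₂_symm hΓ hs u w v, fderiv_apply₂_symm hΓ hs v u w,
    fderiv_apply₂_symm hΓ hs w v u, h0 w v, h0 u v, h0 w u]
  abel

/-- Symmetry of second derivatives, for a function whose first derivatives are known near `p`. -/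
lemma fderiv_symm_of_fderiv_eventuallyEq {f : E → ℝ} (hf : ContDiffAt ℝ ∞ f p) {g : E → E → ℝ}
    (h : ∀ᶠ q in 𝓝 p, ∀ a, fderiv ℝ f q a = g a q) (a b : E) :
    fderiv ℝ (g a) p b = fderiv ℝ (g b) p a := by
  have h2 : DifferentiableAt ℝ (fderiv ℝ f) p :=
    (hf.fderiv_right (m := ∞) (by simp)).differentiableAt (by simp)
  have hsymm : ∀ a b, fderiv ℝ (fderiv ℝ f) p a b = fderiv ℝ (fderiv ℝ f) p b a :=
    (hf.isSymmSndFDerivAt (by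
      rw [minSmoothness_of_isRCLikeNormedField]; exact ENat.LEInfty.out)).eq
  have key (a b : E) : fderiv ℝ (g a) p b = fderiv ℝ (fderiv ℝ f) p b a := by
    have e1 : (fun q ↦ fderiv ℝ f q a) =ᶠ[𝓝 p] g a := by
      filter_upwards [h] with q hq using hq a
    rw [← e1.fderiv_eq, (h2.hasFDerivAt.clm_apply (hasFDerivAt_const a p)).fderiv]
    simp
  rw [key, key, hsymm]

/-- The curvature of a metric connection is skew with respect to the metric. -/
lemma christoffelCurvature_skew {G : E → E →L[ℝ] E →L[ℝ] ℝ} (hΓ : DifferentiableAt ℝ Γ p)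
    (hG : ContDiffAt ℝ ∞ G p)
    (h : ∀ᶠ q in 𝓝 p, ∀ a v w, fderiv ℝ G q a v w = G q (Γ q v a) w + G q v (Γ q w a))
    (u w c d : E) :
    G p (christoffelCurvature Γ p u w c) d + G p c (christoffelCurvature Γ p u w d) = 0 := by
  have hG1 : DifferentiableAt ℝ G p := hG.differentiableAt (by simp)
  have hGe : ∀ᶠ q in 𝓝 p, DifferentiableAt ℝ G q := by
    filter_upwards [(hG.of_le (m := 1) (by simp)).eventually (by simp)] with q hq
    exact hq.differentiableAt (by simp)
  have h0 := h.self_of_nhds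
  have hsymm := fderiv_symm_of_fderiv_eventuallyEq (f := fun q ↦ G q c d)
    (g := fun a q ↦ G q (Γ q c a) d + G q c (Γ q d a)) (by fun_prop) (by
      filter_upwards [h, hGe] with q hq hq' a
      rw [← hq, fderiv_apply₂ hq']) w u
  have key (a b : E) : fderiv ℝ (fun q ↦ G q (Γ q c a) d + G q c (Γ q d a)) p b =
      fderiv ℝ G p b (Γ p c a) d + G p (fderiv ℝ Γ p b c a) d +
      (fderiv ℝ G p b c (Γ p d a) + G p c (fderiv ℝ Γ p b d a)) := by
    rw [(((hG1.hasFDerivAt.clm_apply (hasFDerivAt_apply₂ hΓ c a)).clm_apply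
      (hasFDerivAt_const d p)).fun_add ((hG1.hasFDerivAt.clm_apply (hasFDerivAt_const c p)).clm_apply
        (hasFDerivAt_apply₂ hΓ d a))).fderiv]
    simp
    ring
  rw [key, key] at hsymm
  simp only [h0] at hsymm
  simp only [christoffelCurvature, map_add, map_sub, add_apply, sub_apply]
  linarith

/-- The change of curvature under a projective change of connection. -/
lemma exists_christoffelCurvature_projective {Γ' : E → E →L[ℝ] E →L[ℝ] E}
    (hΓ : DifferentiableAt ℝ Γ p) (hΓ' : DifferentiableAt ℝ Γ' p)
    (hs : ∀ v w, Γ p v w = Γ p w v) {η : E → E → ℝ} (hη : IsLinearMap ℝ (η p))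
    (hd : ∀ v, DifferentiableAt ℝ (fun q ↦ η q v) p)
    (hA : ∀ᶠ q in 𝓝 p, ∀ v w, Γ' q v w = Γ q v w + η q v • w + η q w • v) :
    ∃ P : E → E → ℝ, ∀ u w c, christoffelCurvature Γ' p u w c =
      christoffelCurvature Γ p u w c + (P u w - P w u) • c + P u c • w - P w c • u := by
  have hfd (u v w : E) : fderiv ℝ Γ' p u v w =
      fderiv ℝ Γ p u v w + fderiv ℝ (fun q ↦ η q v) p u • w + fderiv ℝ (fun q ↦ η q w) p u • v := by
    have e1 : (fun q ↦ Γ' q v w) =ᶠ[𝓝 p] fun q ↦ Γ q v w + η q v • w + η q w • v := by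
      filter_upwards [hA] with q hq using hq v w
    rw [← fderiv_apply₂ hΓ', e1.fderiv_eq, (((hasFDerivAt_apply₂ hΓ v w).fun_add
      ((hd v).hasFDerivAt.smul_const w)).fun_add ((hd w).hasFDerivAt.smul_const v)).fderiv]
    simp
  have h0 := hA.self_of_nhds
  refine ⟨fun u c ↦ fderiv ℝ (fun q ↦ η q c) p u - η p (Γ p u c) - η p u * η p c,
    fun u w c ↦ ?_⟩
  simp only [christoffelCurvature, hfd, h0, hη.map_add, hη.map_smul, smul_eq_mul]
  simp only [map_add, map_smul, add_apply, smul_apply, hs u w, hs u c, hs w c]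
  module

end Curvature

/-! ### Volume-preserving and projectively related Christoffel symbols -/

section Projective

variable {Γ Γ' : R3 → R3 →L[ℝ] R3 →L[ℝ] R3} {p : R3}

lemma R3_eq_sum (v : R3) : v = v 0 • EuclideanSpace.single 0 1 + v 1 • EuclideanSpace.single 1 1 +
    v 2 • EuclideanSpace.single 2 1 := by
  ext j
  fin_cases j <;> simp

/-- A connection that preserves a volume form has trace-free curvature. -/
lemma christoffelCurvature_trace {e : R3 → ℝ} (hΓ : DifferentiableAt ℝ Γ p)
    (he : ContDiffAt ℝ ∞ e p) (he0 : e p ≠ 0)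
    (h : ∀ᶠ q in 𝓝 p, ∀ a, fderiv ℝ e q a = (∑ i, Γ q (EuclideanSpace.single i 1) a i) * e q)
    (u w : R3) :
    ∑ i, christoffelCurvature Γ p u w (EuclideanSpace.single i 1) i = 0 := by
  have he1 : DifferentiableAt ℝ e p := he.differentiableAt (by simp)
  have h0 := h.self_of_nhds
  have hsymm := fderiv_symm_of_fderiv_eventuallyEq he h w u
  have key (b a : R3) :
      fderiv ℝ (fun q ↦ (∑ i, Γ q (EuclideanSpace.single i 1) a i) * e q) p b =
      (∑ i, fderiv ℝ Γ p b (EuclideanSpace.single i 1) a i) * e p +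
      (∑ i, Γ p (EuclideanSpace.single i 1) a i) * fderiv ℝ e p b := by
    have d1 (i : Fin 3) : HasFDerivAt (fun q ↦ Γ q (EuclideanSpace.single i 1) a i)
        ((EuclideanSpace.proj i : R3 →L[ℝ] ℝ).comp
          (((fderiv ℝ Γ p).flip (EuclideanSpace.single i 1)).flip a)) p :=
      (EuclideanSpace.proj i : R3 →L[ℝ] ℝ).hasFDerivAt.comp p
        (hasFDerivAt_apply₂ hΓ (EuclideanSpace.single i 1) a)
    have d2 := HasFDerivAt.fun_sum (u := Finset.univ) fun (i : Fin 3) _ ↦ d1 i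
    rw [(d2.fun_mul he1.hasFDerivAt).fderiv]
    simp only [add_apply, smul_apply, smul_eq_mul, Fin.sum_univ_three,
      ContinuousLinearMap.comp_apply, ContinuousLinearMap.flip_apply, PiLp.proj_apply]
    ring
  rw [key, key, h0, h0] at hsymm
  -- the quadratic terms are the trace of a commutator
  have hsum (a v : R3) : Γ p v a = v 0 • Γ p (EuclideanSpace.single 0 1) a +
      v 1 • Γ p (EuclideanSpace.single 1 1) a + v 2 • Γ p (EuclideanSpace.single 2 1) a := by
    conv_lhs => rw [R3_eq_sum v]
    simp only [map_add, map_smul, add_apply, smul_apply]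
  have hcomm : ∑ i, Γ p (Γ p (EuclideanSpace.single i 1) w) u i =
      ∑ i, Γ p (Γ p (EuclideanSpace.single i 1) u) w i := by
    simp only [hsum u (Γ p _ w), hsum w (Γ p _ u), Fin.sum_univ_three, PiLp.add_apply,
      PiLp.smul_apply, smul_eq_mul]
    ring
  have k3 : ((∑ i, fderiv ℝ Γ p u (EuclideanSpace.single i 1) w i) -
      ∑ i, fderiv ℝ Γ p w (EuclideanSpace.single i 1) u i) * e p = 0 := by linarith
  have k4 := (mul_eq_zero.1 k3).resolve_right he0
  simp only [christoffelCurvature, PiLp.add_apply, PiLp.sub_apply, Finset.sum_add_distrib,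
    Finset.sum_sub_distrib]
  linarith

/-- Half the diagonal part of a bilinear map, a covector. -/
def halfDiag (A : R3 →L[ℝ] R3 →L[ℝ] R3) (v : R3) : ℝ :=
  ∑ j, v j * (A (EuclideanSpace.single j 1) (EuclideanSpace.single j 1) j / 2)

/-- A symmetric bilinear map with `A v v` proportional to `v` for all `v` is the symmetric product
of a covector with the identity. -/
lemma eq_halfDiag_smul {A : R3 →L[ℝ] R3 →L[ℝ] R3} (hs : ∀ v w, A v w = A w v)
    (h : ∀ v, ∃ k : ℝ, A v v = k • v) (v w : R3) :
    A v w = halfDiag A v • w + halfDiag A w • v := by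
  set b : Fin 3 → R3 := fun i ↦ EuclideanSpace.single i 1 with hb
  obtain ⟨k, hk⟩ : ∃ k : Fin 3 → ℝ, ∀ j, k j = A (b j) (b j) j := ⟨_, fun _ ↦ rfl⟩
  have hdiag (j : Fin 3) : A (b j) (b j) = k j • b j := by
    obtain ⟨m, hm⟩ := h (b j)
    rw [hk, hm]; simp [hb]
  -- compare the values of the quadratic map at `b j + b l` and at `b j - b l`
  have hoff (j l : Fin 3) (hjl : j ≠ l) :
      A (b j) (b l) = (k l / 2) • b j + (k j / 2) • b l := by
    obtain ⟨m, hm⟩ := h (b j + b l)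
    obtain ⟨n, hn⟩ := h (b j - b l)
    simp only [map_add, map_sub, add_apply, sub_apply, hs (b l) (b j)] at hm hn
    rw [hdiag j, hdiag l] at hm hn
    have c1 := congrArg (fun x : R3 ↦ x j) (congrArg₂ (· + ·) hm hn)
    have c2 := congrArg (fun x : R3 ↦ x l) (congrArg₂ (· + ·) hm hn)
    simp [hb, hjl, hjl.symm] at c1 c2
    have e4 : (4 : ℝ) • A (b j) (b l) = (m - n) • b j + (m + n) • b l := by
      have := congrArg₂ (· - ·) hm hn
      calc (4 : ℝ) • A (b j) (b l) = _ := by module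
        _ = _ := this
        _ = _ := by module
    have e5 : A (b j) (b l) = (1 / 4 : ℝ) • ((m - n) • b j + (m + n) • b l) := by
      rw [← e4]; module
    rw [e5]
    have f1 : m - n = 2 * k l := by linarith
    have f2 : m + n = 2 * k j := by linarith
    rw [f1, f2]
    module
  have hexp (v : R3) : v = v 0 • b 0 + v 1 • b 1 + v 2 • b 2 := R3_eq_sum v
  have hA : A v w = A (v 0 • b 0 + v 1 • b 1 + v 2 • b 2) (w 0 • b 0 + w 1 • b 1 + w 2 • b 2) := by
    rw [← hexp, ← hexp]
  rw [hA]
  conv_rhs => rw [hexp w, hexp v]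
  simp only [map_add, map_smul, add_apply, smul_apply, hdiag 0, hdiag 1, hdiag 2,
    hoff 0 1 (by decide), hoff 1 0 (by decide), hoff 0 2 (by decide), hoff 2 0 (by decide),
    hoff 1 2 (by decide), hoff 2 1 (by decide)]
  have hd (v : R3) : halfDiag A (v 0 • b 0 + v 1 • b 1 + v 2 • b 2) = v 0 * (k 0 / 2)
      + v 1 * (k 1 / 2) + v 2 * (k 2 / 2) := by
    rw [← hexp, halfDiag, Fin.sum_univ_three, hk, hk, hk]
  rw [hd, hd]
  module

/-- The Christoffel symbols of two symmetric connections with the same geodesics differ by the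
symmetric product of a covector with the identity. -/
lemma exists_christoffel_projective (hΓ : DifferentiableAt ℝ Γ p)
    (hΓ' : DifferentiableAt ℝ Γ' p)
    (hs : ∀ᶠ q in 𝓝 p, ∀ v w, Γ q v w = Γ q w v)
    (hs' : ∀ᶠ q in 𝓝 p, ∀ v w, Γ' q v w = Γ' q w v)
    (h : ∀ᶠ q in 𝓝 p, ∀ v, ∃ k : ℝ, Γ' q v v - Γ q v v = k • v) :
    ∃ η : R3 → R3 → ℝ, (∀ q, IsLinearMap ℝ (η q)) ∧
      (∀ v, DifferentiableAt ℝ (fun q ↦ η q v) p) ∧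
      ∀ᶠ q in 𝓝 p, ∀ v w, Γ' q v w = Γ q v w + η q v • w + η q w • v := by
  refine ⟨fun q v ↦ halfDiag (Γ' q - Γ q) v, fun q ↦ ⟨fun v w ↦ ?_, fun a v ↦ ?_⟩, fun v ↦ ?_, ?_⟩
  · simp only [halfDiag, Fin.sum_univ_three, PiLp.add_apply]
    ring
  · simp only [halfDiag, Fin.sum_univ_three, PiLp.smul_apply, smul_eq_mul]
    ring
  · simp only [halfDiag, sub_apply]
    refine DifferentiableAt.fun_sum fun j _ ↦ ?_
    have h1 := (hasFDerivAt_apply₂ hΓ' (EuclideanSpace.single j 1)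
      (EuclideanSpace.single j 1)).differentiableAt.fun_sub (hasFDerivAt_apply₂ hΓ
      (EuclideanSpace.single j 1) (EuclideanSpace.single j 1)).differentiableAt
    have h2 := (EuclideanSpace.proj j : R3 →L[ℝ] ℝ).differentiableAt.comp p h1
    simp only [div_eq_mul_inv]
    exact (h2.mul_const (2 : ℝ)⁻¹).const_mul (v j)
  · filter_upwards [hs, hs', h] with q h1 h2 h3 v w
    have := eq_halfDiag_smul (A := Γ' q - Γ q)
      (fun v w ↦ by rw [sub_apply, sub_apply, sub_apply, sub_apply, h1 v w, h2 v w])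
      (fun v ↦ by rw [sub_apply, sub_apply]; exact h3 v) v w
    rw [sub_apply, sub_apply, sub_eq_iff_eq_add] at this
    rw [this]
    abel

end Projective

/-! ### Curvature algebra in dimension three -/

/-- The Levi-Civita symbol on `{0, 1, 2}`. -/
def levi (i j k : Fin 3) : ℝ := ((j : ℝ) - i) * ((k : ℝ) - j) * ((k : ℝ) - i) / 2

lemma sum_mul_levi (F : Fin 3 → Fin 3 → Fin 3 → ℝ) :
    ∑ i, ∑ j, ∑ k, F i j k * levi i j k =
      F 0 1 2 + F 1 2 0 + F 2 0 1 - F 0 2 1 - F 1 0 2 - F 2 1 0 := by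
  simp only [Fin.sum_univ_three, levi]
  norm_num
  ring

lemma sum_levi_mul (a : Fin 3) (F : Fin 3 → Fin 3 → ℝ) :
    ∑ d, ∑ e, levi d e a * F d e = F (a + 1) (a + 2) - F (a + 2) (a + 1) := by
  obtain rfl | rfl | rfl : a = 0 ∨ a = 1 ∨ a = 2 := by fin_cases a <;> simp
  all_goals
    simp only [Fin.sum_univ_three, levi, Fin.reduceAdd]
    norm_num
    try ring

lemma levi_rotate (i j k : Fin 3) : levi i j k = levi j k i := by
  simp only [levi]; ring

/-- The double contraction with two Levi-Civita symbols computes the determinant. -/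
lemma sum_levi_mul_levi (τ : Fin 3 → Fin 3 → ℝ) :
    ∑ a, ∑ b, ∑ c, ∑ d, ∑ e, ∑ f, τ a b * τ c d * τ e f * levi a c e * levi b d f =
      6 * (Matrix.of τ).det := by
  have h (a b c : Fin 3) : ∑ d, ∑ e, ∑ f, τ a b * τ c d * τ e f * levi a c e * levi b d f =
      ∑ e, ∑ d, ∑ f, τ a b * τ c d * τ e f * levi a c e * levi b d f := Finset.sum_comm
  have h' (a : Fin 3) : ∑ b, ∑ c, ∑ d, ∑ e, ∑ f, τ a b * τ c d * τ e f * levi a c e * levi b d f =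
      ∑ c, ∑ e, (∑ b, ∑ d, ∑ f, τ a b * τ c d * τ e f * levi b d f) * levi a c e := by
    simp only [h]
    rw [Finset.sum_comm]
    refine Finset.sum_congr rfl fun c _ ↦ ?_
    rw [Finset.sum_comm]
    refine Finset.sum_congr rfl fun e _ ↦ ?_
    simp only [Finset.sum_mul]
    refine Finset.sum_congr rfl fun b _ ↦ Finset.sum_congr rfl fun d _ ↦
      Finset.sum_congr rfl fun f _ ↦ ?_
    ring
  simp only [h', sum_mul_levi, Matrix.det_fin_three, Matrix.of_apply]
  ring

/-- The pencil for data satisfying `W a b c = ∑ ε_{hck} (H b h S a k + H a h S b k)`: it is a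
combination of `S` and `H`. -/
lemma pencil_eq {T H S : Fin 3 → Fin 3 → ℝ} (hT : ∀ i j, T i j = T j i)
    (hH : ∀ i j, H i j = H j i) (hS : ∀ i j, S i j = S j i) (b c : Fin 3) :
    ∑ a, ∑ d, ∑ e, T a d *
      (((∑ h, ∑ k, levi h e k * (H b h * S a k + H a h * S b k)) * levi c d e +
        (∑ h, ∑ k, levi h e k * (H c h * S a k + H a h * S c k)) * levi b d e) / 2) =
      (∑ i, ∑ j, T i j * H i j) * S b c - (∑ i, ∑ j, T i j * S i j) * H b c := by
  have h1 (e b : Fin 3) (a : Fin 3) :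
      ∑ h, ∑ k, levi h e k * (H b h * S a k + H a h * S b k) =
        H b (e + 2) * S a (e + 1) + H a (e + 2) * S b (e + 1) -
          (H b (e + 1) * S a (e + 2) + H a (e + 1) * S b (e + 2)) := by
    rw [Finset.sum_comm, ← sum_levi_mul e fun k h ↦ H b h * S a k + H a h * S b k]
    simp only [levi_rotate _ _ e, levi_rotate _ e _]
  have h2 (c : Fin 3) (X : Fin 3 → Fin 3 → ℝ) : ∑ d, ∑ e, X d e * levi c d e =
      X (c + 1) (c + 2) - X (c + 2) (c + 1) := by
    rw [← sum_levi_mul]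
    simp only [levi_rotate c, mul_comm]
  have h3 (a : Fin 3) (Y : Fin 3 → Fin 3 → ℝ) :
      ∑ d, ∑ e, T a d * ((Y b e * levi c d e + Y c e * levi b d e) / 2) =
        ((∑ d, ∑ e, T a d * Y b e * levi c d e) + ∑ d, ∑ e, T a d * Y c e * levi b d e) / 2 := by
    simp only [← Finset.sum_add_distrib, Finset.sum_div]
    refine Finset.sum_congr rfl fun d _ ↦ Finset.sum_congr rfl fun e _ ↦ ?_
    ring
  simp only [h1]
  refine (Finset.sum_congr rfl fun a _ ↦ h3 a fun b e ↦ H b (e + 2) * S a (e + 1) +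
    H a (e + 2) * S b (e + 1) - (H b (e + 1) * S a (e + 2) + H a (e + 1) * S b (e + 2))).trans ?_
  simp only [h2]
  have e0 : (0 : Fin 3) + 1 = 1 ∧ (0 : Fin 3) + 2 = 2 ∧ (1 : Fin 3) + 1 = 2 ∧ (1 : Fin 3) + 2 = 0 ∧
    (2 : Fin 3) + 1 = 0 ∧ (2 : Fin 3) + 2 = 1 := by decide
  obtain ⟨e1, e2, e3, e4, e5, e6⟩ := e0
  obtain rfl | rfl | rfl : b = 0 ∨ b = 1 ∨ b = 2 := by fin_cases b <;> simp
  all_goals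
    obtain rfl | rfl | rfl : c = 0 ∨ c = 1 ∨ c = 2 := by fin_cases c <;> simp
    all_goals
      simp only [Fin.sum_univ_three, e1, e2, e3, e4, e5, e6, hT 1 0, hT 2 0, hT 2 1, hH 1 0,
        hH 2 0, hH 2 1, hS 1 0, hS 2 0, hS 2 1]
      ring

/-- If `S` is not proportional to `H`, some symmetric `T` is orthogonal to `H` but not to `S`. -/
lemma exists_symm_orthogonal {G H S : Matrix (Fin 3) (Fin 3) ℝ} (hG : G.IsSymm) (hH : H.IsSymm)
    (hS : S.IsSymm) (hGH : G * H = 1) (h : ¬ ∃ μ : ℝ, S = μ • H) :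
    ∃ T : Matrix (Fin 3) (Fin 3) ℝ, T.IsSymm ∧ (T * H).trace = 0 ∧ (T * S).trace ≠ 0 := by
  by_contra! hc
  refine h ⟨(G * S).trace / 3, ?_⟩
  have key (T : Matrix (Fin 3) (Fin 3) ℝ) (hT : T.IsSymm) :
      (T * S).trace = (G * S).trace / 3 * (T * H).trace := by
    -- subtract a multiple of `G` to make `T` orthogonal to `H`, using `tr (G H) = 3`
    have h1 := hc (T - ((T * H).trace / 3) • G) (hT.sub (hG.smul _)) (by
      simp [Matrix.sub_mul, hGH])
    simp only [Matrix.sub_mul, Matrix.smul_mul, Matrix.trace_sub, Matrix.trace_smul,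
      smul_eq_mul] at h1
    linarith
  ext a b
  have h2 := key (Matrix.single a b 1 + Matrix.single b a 1) (by
    rw [Matrix.IsSymm, Matrix.transpose_add, Matrix.transpose_single, Matrix.transpose_single,
      add_comm])
  simp only [Matrix.add_mul, Matrix.trace_add, Matrix.trace_single_mul, smul_eq_mul,
    one_mul] at h2
  rw [Matrix.smul_apply, smul_eq_mul]
  rw [hS.apply a b, hH.apply a b] at h2
  linarith

/-! ### Change of basis, and the Weyl tensor of a metric -/

section CurvatureAlgebra

variable {V : Type*} [AddCommGroup V] [Module ℝ V]

/-- The lowered curvature of a metric connection, with both its skew pairs of indices replaced by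
single ones in a basis `B`: the component `(a, k)` belongs to the pairs `(a + 1, a + 2)` and
`(k + 1, k + 2)`, read modulo `3`. -/
def dualCurvature (g : LinearMap.BilinForm ℝ V) (R : V →ₗ[ℝ] V →ₗ[ℝ] V →ₗ[ℝ] V)
    (B : Module.Basis (Fin 3) ℝ V) : Matrix (Fin 3) (Fin 3) ℝ :=
  Matrix.of fun a k ↦ g (B (k + 1)) (R (B (a + 1)) (B (a + 2)) (B (k + 2)))

lemma fin3_add : (0 : Fin 3) + 1 = 1 ∧ (0 : Fin 3) + 2 = 2 ∧ (1 : Fin 3) + 1 = 2 ∧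
    (1 : Fin 3) + 2 = 0 ∧ (2 : Fin 3) + 1 = 0 ∧ (2 : Fin 3) + 2 = 1 := by decide

lemma fin3_cases (a : Fin 3) : a = 0 ∨ a = 1 ∨ a = 2 := by fin_cases a <;> simp

/-- Components of a skew form, indexed by the complement of a pair, transform with the adjugate. -/
lemma skew_basis_change {β : V → V → ℝ} (hl : ∀ v, IsLinearMap ℝ fun u ↦ β u v)
    (ha : ∀ u v, β u v = -β v u) (B₀ B : Module.Basis (Fin 3) ℝ V) (a : Fin 3) :
    β (B (a + 1)) (B (a + 2)) =
      ∑ i, (B₀.toMatrix B).adjugate a i * β (B₀ (i + 1)) (B₀ (i + 2)) := by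
  have hr (u : V) : IsLinearMap ℝ fun v ↦ β u v := by
    refine ⟨fun v w ↦ ?_, fun c v ↦ ?_⟩
    · rw [ha, (hl u).map_add, ha u v, ha u w]; ring
    · rw [ha, (hl u).map_smul, ha u v, smul_eq_mul, smul_eq_mul]; ring
  have hB (j : Fin 3) : B j = B₀.toMatrix B 0 j • B₀ 0 + B₀.toMatrix B 1 j • B₀ 1 +
      B₀.toMatrix B 2 j • B₀ 2 := by
    rw [← Fin.sum_univ_three fun i ↦ B₀.toMatrix B i j • B₀ i, B₀.sum_toMatrix_smul_self]
  have h0 (u : V) : β u u = 0 := by linarith [ha u u]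
  obtain ⟨e1, e2, e3, e4, e5, e6⟩ := fin3_add
  generalize B₀.toMatrix B = N at hB
  rw [Matrix.adjugate_fin_three, hB, hB]
  simp only [(hl _).map_add, (hl _).map_smul, (hr _).map_add, (hr _).map_smul, h0,
    ha (B₀ 1) (B₀ 0), ha (B₀ 0) (B₀ 2), ha (B₀ 2) (B₀ 1), smul_eq_mul]
  obtain rfl | rfl | rfl := fin3_cases a
  all_goals
    simp [Fin.sum_univ_three, e1, e2, e3, e4, e5, e6]
    ring

variable {g : LinearMap.BilinForm ℝ V} {R : V →ₗ[ℝ] V →ₗ[ℝ] V →ₗ[ℝ] V}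

lemma dualCurvature_basis_change (hanti : ∀ u v w, R u v w = -R v u w)
    (hskew : ∀ u v c d, g (R u v c) d + g c (R u v d) = 0) (hg : ∀ u v, g u v = g v u)
    (B₀ B : Module.Basis (Fin 3) ℝ V) :
    dualCurvature g R B = (B₀.toMatrix B).adjugate * dualCurvature g R B₀ *
      (B₀.toMatrix B).adjugate.transpose := by
  refine Matrix.ext fun a k ↦ ?_
  have h1 := skew_basis_change (β := fun u v ↦ g (B (k + 1)) (R u v (B (k + 2))))
    (fun v ↦ ⟨by simp, by simp⟩) (fun u v ↦ by rw [hanti, map_neg]) B₀ B a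
  have h2 (i : Fin 3) := skew_basis_change (β := fun u v ↦ g u (R (B₀ (i + 1)) (B₀ (i + 2)) v))
    (fun v ↦ ⟨by simp, by simp⟩)
    (fun u v ↦ by
      have := hskew (B₀ (i + 1)) (B₀ (i + 2)) v u
      rw [hg _ u] at this
      linarith) B₀ B k
  simp only [dualCurvature, Matrix.mul_apply, Matrix.of_apply, h1, h2, Matrix.transpose_apply,
    Fin.sum_univ_three]
  ring

/-- The pair symmetry of the curvature, a consequence of the Bianchi identity. -/
lemma dualCurvature_isSymm (hb : ∀ u v w, R u v w + R v w u + R w u v = 0)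
    (hskew : ∀ u v c d, g (R u v c) d + g c (R u v d) = 0) (hg : ∀ u v, g u v = g v u)
    (B : Module.Basis (Fin 3) ℝ V) : (dualCurvature g R B).IsSymm := by
  have h0 (u v w : V) : g w (R u v w) = 0 := by linarith [hskew u v w w, hg (R u v w) w]
  have h1 (u v w : V) : g v (R u v w) = g u (R v w v) := by
    have := congrArg (g v) (hb u v w)
    rw [map_add, map_add, map_zero] at this
    have h2 := hskew v w u v
    have h3 := h0 w u v
    rw [hg _ v] at h2
    linarith
  refine Matrix.IsSymm.ext fun a k ↦ ?_
  obtain ⟨e1, e2, e3, e4, e5, e6⟩ := fin3_add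
  simp only [dualCurvature, Matrix.of_apply]
  obtain rfl | rfl | rfl := fin3_cases a <;> obtain rfl | rfl | rfl := fin3_cases k <;>
    simp only [e1, e2, e3, e4, e5, e6]
  · exact (h1 _ _ _).symm
  · exact h1 _ _ _
  · exact h1 _ _ _
  · exact (h1 _ _ _).symm
  · exact (h1 _ _ _).symm
  · exact h1 _ _ _

/-- Raising an index with the inverse of the Gram matrix. -/
lemma repr_eq_sum_inv_toMatrix (hn : g.Nondegenerate) (B : Module.Basis (Fin 3) ℝ V) (v : V)
    (b : Fin 3) :
    B.repr v b = ∑ h, (LinearMap.BilinForm.toMatrix B g)⁻¹ b h * g (B h) v := by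
  have hdet := (LinearMap.BilinForm.nondegenerate_iff_det_ne_zero B).1 hn
  have h1 : (LinearMap.BilinForm.toMatrix B g).mulVec (B.repr v) = fun h ↦ g (B h) v := by
    ext h
    conv_rhs => rw [← B.sum_repr v, map_sum]
    simp only [Matrix.mulVec, dotProduct, LinearMap.BilinForm.toMatrix_apply, map_smul,
      smul_eq_mul, mul_comm]
  have h2 := congrArg (LinearMap.BilinForm.toMatrix B g)⁻¹.mulVec h1
  simp only [Matrix.mulVec_mulVec, Matrix.nonsing_inv_mul _ hdet.isUnit, Matrix.one_mulVec] at h2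
  rw [h2, Matrix.mulVec, dotProduct]

/-- The curvature of a metric connection, recovered from its dual: a skew pair of indices in
dimension three is dual to a single index. -/
lemma repr_metric_curvature (hg : ∀ u v, g u v = g v u) (hn : g.Nondegenerate)
    (hskew : ∀ u v c d, g (R u v c) d + g c (R u v d) = 0)
    (B : Module.Basis (Fin 3) ℝ V) (a b c : Fin 3) :
    B.repr (R (B (a + 1)) (B (a + 2)) (B c)) b = ∑ h, ∑ k,
      levi h c k * ((LinearMap.BilinForm.toMatrix B g)⁻¹ b h * dualCurvature g R B a k) := by
  rw [repr_eq_sum_inv_toMatrix hn]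
  refine Finset.sum_congr rfl fun h _ ↦ ?_
  obtain ⟨e1, e2, e3, e4, e5, e6⟩ := fin3_add
  simp only [dualCurvature, Matrix.of_apply, Fin.sum_univ_three, e1, e2, e3, e4, e5, e6]
  have hN (i j : Fin 3) : g (B i) (R (B (a + 1)) (B (a + 2)) (B j)) =
      -g (B j) (R (B (a + 1)) (B (a + 2)) (B i)) := by
    have := hskew (B (a + 1)) (B (a + 2)) (B j) (B i)
    rw [hg _ (B i)] at this
    linarith
  have hN0 (i : Fin 3) : g (B i) (R (B (a + 1)) (B (a + 2)) (B i)) = 0 := by linarith [hN i i]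
  obtain rfl | rfl | rfl := fin3_cases h <;> obtain rfl | rfl | rfl := fin3_cases c <;>
    simp [levi, hN0, hN 1 0, hN 2 1, hN 0 2]
  all_goals norm_num

variable {R' : V →ₗ[ℝ] V →ₗ[ℝ] V →ₗ[ℝ] V} {P : V → V → ℝ}

lemma trace_eq_sum_repr (B : Module.Basis (Fin 3) ℝ V) (A : V →ₗ[ℝ] V) :
    LinearMap.trace ℝ V A = ∑ i, B.repr (A (B i)) i := by
  simp [LinearMap.trace_eq_matrix_trace ℝ B, Matrix.trace, LinearMap.toMatrix_apply]

lemma toMatrix_isSymm (hg : ∀ u v, g u v = g v u) (B : Module.Basis (Fin 3) ℝ V) :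
    (LinearMap.BilinForm.toMatrix B g).IsSymm :=
  Matrix.IsSymm.ext fun i j ↦ by
    rw [LinearMap.BilinForm.toMatrix_apply, LinearMap.BilinForm.toMatrix_apply, hg]

lemma trace_metric_curvature (hg : ∀ u v, g u v = g v u) (hn : g.Nondegenerate)
    (hskew : ∀ u v c d, g (R u v c) d + g c (R u v d) = 0)
    (B : Module.Basis (Fin 3) ℝ V) (u v : V) : ∑ i, B.repr (R u v (B i)) i = 0 := by
  have hH (i j : Fin 3) := (toMatrix_isSymm hg B).inv.apply i j
  have hN (i j : Fin 3) : g (B i) (R u v (B j)) = -g (B j) (R u v (B i)) := by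
    have := hskew u v (B j) (B i)
    rw [hg _ (B i)] at this
    linarith
  have hN0 (i : Fin 3) : g (B i) (R u v (B i)) = 0 := by linarith [hN i i]
  simp only [repr_eq_sum_inv_toMatrix hn, Fin.sum_univ_three, hN0, hN 1 0, hN 2 0, hN 2 1,
    hH 0 1, hH 0 2, hH 1 2]
  ring

/-- The symmetrised curvature of a volume-preserving connection depends only on the projective
class, so it can be computed with the metric connection. -/
lemma repr_projective_curvature (hg : ∀ u v, g u v = g v u) (hn : g.Nondegenerate)
    (hskew : ∀ u v c d, g (R u v c) d + g c (R u v d) = 0)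
    (hP : ∀ u v w, R' u v w = R u v w + (P u v - P v u) • w + P u w • v - P v w • u)
    (htr : ∀ u v, LinearMap.trace ℝ V (R' u v) = 0)
    (B : Module.Basis (Fin 3) ℝ V) (a b c : Fin 3) :
    B.repr (R' (B (a + 1)) (B (a + 2)) (B c)) b + B.repr (R' (B (b + 1)) (B (b + 2)) (B c)) a =
      B.repr (R (B (a + 1)) (B (a + 2)) (B c)) b + B.repr (R (B (b + 1)) (B (b + 2)) (B c)) a := by
  -- both curvatures are trace-free, and the trace of the correction is `4 (P d e - P e d)`
  have hsymm (d e : Fin 3) : P (B d) (B e) = P (B e) (B d) := by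
    have h1 := htr (B d) (B e)
    rw [trace_eq_sum_repr B] at h1
    simp only [hP, map_add, map_sub, map_smul, Finsupp.add_apply, Finsupp.sub_apply,
      Finsupp.smul_apply, Finset.sum_add_distrib, Finset.sum_sub_distrib,
      trace_metric_curvature hg hn hskew, B.repr_self, smul_eq_mul, Finsupp.single_apply] at h1
    simp at h1
    linarith
  -- the remaining correction is skew in `a` and `b`
  obtain ⟨e1, e2, e3, e4, e5, e6⟩ := fin3_add
  simp only [hP, map_add, map_sub, map_smul, Finsupp.add_apply, Finsupp.sub_apply,
      Finsupp.smul_apply, hsymm, sub_self, zero_smul, add_zero]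
  obtain rfl | rfl | rfl := fin3_cases a <;> obtain rfl | rfl | rfl := fin3_cases b <;>
    simp [e1, e2, e3, e4, e5, e6]

/-- The contraction `T_{ij} g^{ij}` does not depend on the basis. -/
lemma trace_mul_inv_basis_change (t : LinearMap.BilinForm ℝ V) (B₀ B : Module.Basis (Fin 3) ℝ V) :
    (LinearMap.BilinForm.toMatrix B t * (LinearMap.BilinForm.toMatrix B g)⁻¹).trace =
      (LinearMap.BilinForm.toMatrix B₀ t * (LinearMap.BilinForm.toMatrix B₀ g)⁻¹).trace := by
  rw [← LinearMap.BilinForm.toMatrix_mul_basis_toMatrix B₀ B t,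
    ← LinearMap.BilinForm.toMatrix_mul_basis_toMatrix B₀ B g]
  have hN : IsUnit (B₀.toMatrix B).det := by
    have := B₀.invertibleToMatrix B
    exact Matrix.isUnit_det_of_invertible _
  have hN' : IsUnit (B₀.toMatrix B).transpose.det := by rwa [Matrix.det_transpose]
  rw [Matrix.mul_inv_rev, Matrix.mul_inv_rev, Matrix.mul_assoc, Matrix.mul_assoc,
    Matrix.trace_mul_comm, ← Matrix.mul_assoc (B₀.toMatrix B),
    Matrix.mul_nonsing_inv _ hN, Matrix.one_mul, Matrix.mul_assoc, Matrix.mul_assoc,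
    Matrix.nonsing_inv_mul _ hN', Matrix.mul_one]

/-- The contraction `T_{ij} S^{ij}` with the dual curvature is a density of weight two: its vanishing
does not depend on the basis. -/
lemma trace_mul_dualCurvature_basis_change (hanti : ∀ u v w, R u v w = -R v u w)
    (hskew : ∀ u v c d, g (R u v c) d + g c (R u v d) = 0) (hg : ∀ u v, g u v = g v u)
    (t : LinearMap.BilinForm ℝ V) (B₀ B : Module.Basis (Fin 3) ℝ V) :
    (LinearMap.BilinForm.toMatrix B t * dualCurvature g R B).trace =
      (B₀.toMatrix B).det ^ 2 *
        (LinearMap.BilinForm.toMatrix B₀ t * dualCurvature g R B₀).trace := by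
  rw [← LinearMap.BilinForm.toMatrix_mul_basis_toMatrix B₀ B t,
    dualCurvature_basis_change hanti hskew hg B₀ B]
  rw [Matrix.mul_assoc, Matrix.mul_assoc, Matrix.trace_mul_comm,
    ← Matrix.mul_assoc (B₀.toMatrix B), ← Matrix.mul_assoc (B₀.toMatrix B), Matrix.mul_adjugate,
    Matrix.smul_mul, Matrix.one_mul]
  simp only [Matrix.smul_mul, Matrix.mul_smul, Matrix.mul_assoc, Matrix.trace_smul,
    ← Matrix.transpose_mul, Matrix.mul_adjugate, Matrix.transpose_smul, Matrix.transpose_one,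
    Matrix.mul_one, smul_eq_mul]
  ring

end CurvatureAlgebra

/-! ### The pencil of symmetric contravariant tensors -/

section Pencil

variable {V : Type*} [AddCommGroup V] [Module ℝ V] {g : LinearMap.BilinForm ℝ V}
  {R R' : V →ₗ[ℝ] V →ₗ[ℝ] V →ₗ[ℝ] V} {P : V → V → ℝ}

/-- Components of the Weyl tensor of a volume-preserving connection with curvature `R`, for the
volume form that takes the value `1` on the basis `B`. -/
def weylComponent (R : V →ₗ[ℝ] V →ₗ[ℝ] V →ₗ[ℝ] V) (B : Module.Basis (Fin 3) ℝ V)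
    (a b c : Fin 3) : ℝ :=
  B.repr (R (B (a + 1)) (B (a + 2)) (B c)) b + B.repr (R (B (b + 1)) (B (b + 2)) (B c)) a

/-- In the presence of a metric, the Weyl tensor is made of the inverse metric and the dual
curvature alone. -/
lemma weylComponent_eq (hg : ∀ u v, g u v = g v u) (hn : g.Nondegenerate)
    (hskew : ∀ u v c d, g (R u v c) d + g c (R u v d) = 0)
    (hP : ∀ u v w, R' u v w = R u v w + (P u v - P v u) • w + P u w • v - P v w • u)
    (htr : ∀ u v, LinearMap.trace ℝ V (R' u v) = 0)
    (B : Module.Basis (Fin 3) ℝ V) (a b c : Fin 3) :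
    weylComponent R' B a b c = ∑ h, ∑ k, levi h c k *
      ((LinearMap.BilinForm.toMatrix B g)⁻¹ b h * dualCurvature g R B a k +
        (LinearMap.BilinForm.toMatrix B g)⁻¹ a h * dualCurvature g R B b k) := by
  rw [weylComponent, repr_projective_curvature hg hn hskew hP htr,
    repr_metric_curvature hg hn hskew, repr_metric_curvature hg hn hskew]
  simp only [mul_add, Finset.sum_add_distrib]

/-- The Weyl tensor vanishes if the dual curvature is a multiple `μ` of the inverse metric. -/
lemma sum_levi_symm (H : Fin 3 → Fin 3 → ℝ) (μ : ℝ) (a b c : Fin 3) :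
    ∑ h, ∑ k, levi h c k * (H b h * (μ * H a k) + H a h * (μ * H b k)) = 0 := by
  obtain rfl | rfl | rfl := fin3_cases c
  all_goals
    simp only [Fin.sum_univ_three, levi]
    norm_num
    ring

/-- If the Weyl tensor does not vanish, there is a symmetric form whose pencil is a non-degenerate
multiple of the inverse metric, in every basis. -/
lemma exists_symm_pencil_det_ne_zero (hg : ∀ u v, g u v = g v u) (hn : g.Nondegenerate)
    (hanti : ∀ u v w, R u v w = -R v u w)
    (hb : ∀ u v w, R u v w + R v w u + R w u v = 0)
    (hskew : ∀ u v c d, g (R u v c) d + g c (R u v d) = 0)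
    (hP : ∀ u v w, R' u v w = R u v w + (P u v - P v u) • w + P u w • v - P v w • u)
    (htr : ∀ u v, LinearMap.trace ℝ V (R' u v) = 0)
    (B₀ : Module.Basis (Fin 3) ℝ V) (hW : ∃ a b c, weylComponent R' B₀ a b c ≠ 0) :
    ∃ t : LinearMap.BilinForm ℝ V, (∀ u v, t u v = t v u) ∧
      ∀ B : Module.Basis (Fin 3) ℝ V, (Matrix.of fun b c ↦ ∑ a, ∑ d, ∑ e, t (B a) (B d) *
        ((weylComponent R' B a b e * levi c d e + weylComponent R' B a c e * levi b d e) / 2)).det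
          ≠ 0 := by
  have hdet (B : Module.Basis (Fin 3) ℝ V) : IsUnit (LinearMap.BilinForm.toMatrix B g).det :=
    ((LinearMap.BilinForm.nondegenerate_iff_det_ne_zero B).1 hn).isUnit
  have hH (B : Module.Basis (Fin 3) ℝ V) := (toMatrix_isSymm hg B).inv
  have hS (B : Module.Basis (Fin 3) ℝ V) := dualCurvature_isSymm hb hskew hg B
  have hprop : ¬ ∃ μ : ℝ, dualCurvature g R B₀ = μ • (LinearMap.BilinForm.toMatrix B₀ g)⁻¹ := by
    rintro ⟨μ, hμ⟩
    obtain ⟨a, b, c, h⟩ := hW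
    apply h
    rw [weylComponent_eq hg hn hskew hP htr, hμ]
    exact sum_levi_symm _ μ a b c
  obtain ⟨T, hT, h1, h2⟩ := exists_symm_orthogonal (toMatrix_isSymm hg B₀) (hH B₀) (hS B₀)
    (Matrix.mul_nonsing_inv _ (hdet B₀)) hprop
  have hTt : LinearMap.BilinForm.toMatrix B₀ (Matrix.toBilin B₀ T) = T :=
    LinearMap.BilinForm.toMatrix_toBilin B₀ T
  generalize Matrix.toBilin B₀ T = t at hTt
  have ht (u v : V) : t u v = t v u := by
    have : t = t.flip := by
      refine LinearMap.BilinForm.ext_basis B₀ fun i j ↦ ?_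
      have := hT.apply i j
      rw [← hTt, LinearMap.BilinForm.toMatrix_apply, LinearMap.BilinForm.toMatrix_apply] at this
      exact this.symm
    conv_lhs => rw [this]
    rfl
  refine ⟨t, ht, fun B ↦ ?_⟩
  set H := (LinearMap.BilinForm.toMatrix B g)⁻¹ with hHdef
  set S := dualCurvature g R B with hSdef
  have hdetN : (B₀.toMatrix B).det ≠ 0 := by
    have := B₀.invertibleToMatrix B
    exact (Matrix.isUnit_det_of_invertible _).ne_zero
  have tr (X : Matrix (Fin 3) (Fin 3) ℝ) (hX : X.IsSymm) : ∑ i, ∑ j, t (B i) (B j) * X i j =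
      (LinearMap.BilinForm.toMatrix B t * X).trace := by
    simp only [Matrix.trace, Matrix.diag, Matrix.mul_apply, LinearMap.BilinForm.toMatrix_apply]
    refine Finset.sum_congr rfl fun i _ ↦ Finset.sum_congr rfl fun j _ ↦ ?_
    rw [hX.apply i j]
  have k1 : ∑ i, ∑ j, t (B i) (B j) * H i j = 0 := by
    rw [tr H (hH B), trace_mul_inv_basis_change t B₀ B, hTt, h1]
  have k2 : ∑ i, ∑ j, t (B i) (B j) * S i j ≠ 0 := by
    rw [tr S (hS B), trace_mul_dualCurvature_basis_change hanti hskew hg t B₀ B, hTt]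
    exact mul_ne_zero (pow_ne_zero 2 hdetN) h2
  have key : (Matrix.of fun b c ↦ ∑ a, ∑ d, ∑ e, t (B a) (B d) *
      ((weylComponent R' B a b e * levi c d e + weylComponent R' B a c e * levi b d e) / 2)) =
      (-∑ i, ∑ j, t (B i) (B j) * S i j) • H := by
    ext b c
    simp only [weylComponent_eq hg hn hskew hP htr, Matrix.of_apply]
    rw [pencil_eq (T := fun a d ↦ t (B a) (B d)) (H := H) (S := S) (fun i j ↦ ht _ _)
      (fun i j ↦ (hH B).apply j i) (fun i j ↦ (hS B).apply j i), k1, Matrix.smul_apply,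
      smul_eq_mul]
    ring
  rw [key, Matrix.det_smul]
  refine mul_ne_zero (pow_ne_zero _ (neg_ne_zero.2 k2)) ?_
  exact ((Matrix.isUnit_nonsing_inv_det_iff).2 (hdet B)).ne_zero

end Pencil

/-! ### Components of the volume form and of the pencil -/

lemma alternating_swap₀₁ {V : Type*} [AddCommGroup V] [Module ℝ V] (f : V [⋀^Fin 3]→ₗ[ℝ] ℝ)
    (u v w : V) : f ![v, u, w] = -f ![u, v, w] := by
  rw [← f.map_swap ![u, v, w] (show (0 : Fin 3) ≠ 1 by decide)]
  congr 1
  ext i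
  fin_cases i <;> rfl

lemma alternating_swap₁₂ {V : Type*} [AddCommGroup V] [Module ℝ V] (f : V [⋀^Fin 3]→ₗ[ℝ] ℝ)
    (u v w : V) : f ![u, w, v] = -f ![u, v, w] := by
  rw [← f.map_swap ![u, v, w] (show (1 : Fin 3) ≠ 2 by decide)]
  congr 1
  ext i
  fin_cases i <;> rfl

/-- An alternating 3-form in three dimensions has one component. -/
lemma alternating_apply_levi {V : Type*} [AddCommGroup V] [Module ℝ V] (f : V [⋀^Fin 3]→ₗ[ℝ] ℝ)
    (u : Fin 3 → V) (i j k : Fin 3) :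
    f ![u i, u j, u k] = f ![u 0, u 1, u 2] * levi i j k := by
  have h1 (a b : V) : f ![a, a, b] = 0 := by linarith [alternating_swap₀₁ f a a b]
  have h2 (a b : V) : f ![b, a, a] = 0 := by linarith [alternating_swap₁₂ f b a a]
  have h3 (a b : V) : f ![a, b, a] = 0 := by linarith [alternating_swap₁₂ f a a b, h1 a b]
  have p1 := alternating_swap₀₁ f (u 0) (u 1) (u 2)
  have p2 := alternating_swap₁₂ f (u 0) (u 1) (u 2)
  have p3 := alternating_swap₀₁ f (u 0) (u 2) (u 1)
  have p4 := alternating_swap₁₂ f (u 1) (u 0) (u 2)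
  have p5 := alternating_swap₀₁ f (u 1) (u 2) (u 0)
  obtain rfl | rfl | rfl := fin3_cases i <;> obtain rfl | rfl | rfl := fin3_cases j <;>
    obtain rfl | rfl | rfl := fin3_cases k <;> simp only [h1, h2, h3, p5, p4, p3, p2, p1, levi] <;>
    norm_num

section Components

variable {M : Type*} [TopologicalSpace M] [ChartedSpace R3 M] [IsManifold (𝓡 3) ∞ M]
  {x : M} (B : Module.Basis (Fin 3) ℝ (TangentSpace (𝓡 3) x))

lemma VolumeForm.lower_eq (ε : VolumeForm M) (i j k : Fin 3) :
    ε.lower B i j k = ε.lower B 0 1 2 * levi i j k :=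
  alternating_apply_levi (ε.toFun x) B i j k

lemma VolumeForm.lower_ne_zero (ε : VolumeForm M) : ε.lower B 0 1 2 ≠ 0 := by
  intro h
  refine ε.ne_zero x (B.ext_alternating fun v _ ↦ ?_)
  have h1 := ε.lower_eq B (v 0) (v 1) (v 2)
  rw [h, zero_mul] at h1
  rw [AlternatingMap.zero_apply, ← h1, VolumeForm.lower]
  congr 1
  ext i
  fin_cases i <;> rfl

lemma VolumeForm.upper_eq (ε : VolumeForm M) (i j k : Fin 3) :
    ε.upper B i j k = (ε.lower B 0 1 2)⁻¹ * levi i j k := by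
  have := ε.lower_ne_zero B
  rw [VolumeForm.upper, ε.lower_eq]
  field_simp

lemma weyl_eq (cov : AffineConnection M) (ε : VolumeForm M)
    {R : TangentSpace (𝓡 3) x →ₗ[ℝ] TangentSpace (𝓡 3) x →ₗ[ℝ] TangentSpace (𝓡 3) x →ₗ[ℝ]
      TangentSpace (𝓡 3) x}
    (hR : ∀ u v w, R u v w = secondCov cov (FiberBundle.extend R3 w) x u v -
      secondCov cov (FiberBundle.extend R3 w) x v u) (a b c : Fin 3) :
    weyl cov ε B a b c = (ε.lower B 0 1 2)⁻¹ * weylComponent R B a b c := by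
  simp only [weyl, ε.upper_eq, mul_assoc, ← mul_add, ← Finset.mul_sum, Finset.sum_add_distrib]
  rw [sum_levi_mul a fun d e ↦ B.repr (secondCov cov (FiberBundle.extend R3 (B c)) x (B d) (B e)) b,
    sum_levi_mul b fun d e ↦ B.repr (secondCov cov (FiberBundle.extend R3 (B c)) x (B d) (B e)) a]
  simp only [weylComponent, hR, map_sub, Finsupp.sub_apply]

lemma weylPencil_eq (cov : AffineConnection M) (ε : VolumeForm M) (T : SymTwoTensor M)
    {R : TangentSpace (𝓡 3) x →ₗ[ℝ] TangentSpace (𝓡 3) x →ₗ[ℝ] TangentSpace (𝓡 3) x →ₗ[ℝ]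
      TangentSpace (𝓡 3) x}
    (hR : ∀ u v w, R u v w = secondCov cov (FiberBundle.extend R3 w) x u v -
      secondCov cov (FiberBundle.extend R3 w) x v u) (b c : Fin 3) :
    weylPencil cov ε T B b c = (ε.lower B 0 1 2)⁻¹ ^ 2 * ∑ a, ∑ d, ∑ e, T.toFun x (B a) (B d) *
        ((weylComponent R B a b e * levi c d e + weylComponent R B a c e * levi b d e) / 2) := by
  simp only [weylPencil, weyl_eq B cov ε hR, ε.upper_eq, Finset.mul_sum]
  refine Finset.sum_congr rfl fun a _ ↦ Finset.sum_congr rfl fun d _ ↦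
    Finset.sum_congr rfl fun e _ ↦ ?_
  ring

lemma tensorDet_eq (ε : VolumeForm M) (τ : Fin 3 → Fin 3 → ℝ) :
    tensorDet ε B τ = ε.lower B 0 1 2 ^ 2 * (6 * (Matrix.of τ).det) := by
  rw [← sum_levi_mul_levi]
  simp only [tensorDet, Finset.mul_sum]
  refine Finset.sum_congr rfl fun a _ ↦ Finset.sum_congr rfl fun b _ ↦
    Finset.sum_congr rfl fun c _ ↦ Finset.sum_congr rfl fun d _ ↦
    Finset.sum_congr rfl fun e _ ↦ Finset.sum_congr rfl fun f _ ↦ ?_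
  rw [ε.lower_eq B a c e, ε.lower_eq B b d f]
  ring

end Components

/-! ### The curvature at a point of the manifold -/

lemma christoffelCurvature_add_left {E : Type*} [NormedAddCommGroup E] [NormedSpace ℝ E]
    (Γ : E → E →L[ℝ] E →L[ℝ] E) (p u v w c : E) : christoffelCurvature Γ p (u + v) w c =
      christoffelCurvature Γ p u w c + christoffelCurvature Γ p v w c := by
  simp only [christoffelCurvature, ContinuousLinearMap.map_add, add_apply]
  abel

lemma christoffelCurvature_smul_left {E : Type*} [NormedAddCommGroup E] [NormedSpace ℝ E]
    (Γ : E → E →L[ℝ] E →L[ℝ] E) (p : E) (a : ℝ) (u w c : E) :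
    christoffelCurvature Γ p (a • u) w c = a • christoffelCurvature Γ p u w c := by
  simp only [christoffelCurvature, ContinuousLinearMap.map_smul, smul_apply, smul_sub, smul_add]

lemma christoffelCurvature_add_right {E : Type*} [NormedAddCommGroup E] [NormedSpace ℝ E]
    (Γ : E → E →L[ℝ] E →L[ℝ] E) (p u w c d : E) : christoffelCurvature Γ p u w (c + d) =
      christoffelCurvature Γ p u w c + christoffelCurvature Γ p u w d := by
  simp only [christoffelCurvature, ContinuousLinearMap.map_add, add_apply]
  abel

lemma christoffelCurvature_smul_right {E : Type*} [NormedAddCommGroup E] [NormedSpace ℝ E]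
    (Γ : E → E →L[ℝ] E →L[ℝ] E) (p : E) (a : ℝ) (u w c : E) :
    christoffelCurvature Γ p u w (a • c) = a • christoffelCurvature Γ p u w c := by
  simp only [christoffelCurvature, ContinuousLinearMap.map_smul, smul_apply, smul_sub, smul_add]

/-- `christoffelCurvature` as a trilinear map. -/
def curvatureMap {E : Type*} [NormedAddCommGroup E] [NormedSpace ℝ E]
    (Γ : E → E →L[ℝ] E →L[ℝ] E) (p : E) : E →ₗ[ℝ] E →ₗ[ℝ] E →ₗ[ℝ] E :=
  LinearMap.mk₂ ℝ (fun u w ↦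
    { toFun := christoffelCurvature Γ p u w
      map_add' := christoffelCurvature_add_right Γ p u w
      map_smul' := fun a c ↦ christoffelCurvature_smul_right Γ p a u w c })
    (fun u v w ↦ LinearMap.ext fun c ↦ christoffelCurvature_add_left Γ p u v w c)
    (fun a u w ↦ LinearMap.ext fun c ↦ christoffelCurvature_smul_left Γ p a u w c)
    (fun u v w ↦ LinearMap.ext fun c ↦ by
      change christoffelCurvature Γ p u (v + w) c =
        christoffelCurvature Γ p u v c + christoffelCurvature Γ p u w c
      simp only [christoffelCurvature_antisymm Γ p u, christoffelCurvature_add_left, neg_add])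
    (fun a u w ↦ LinearMap.ext fun c ↦ by
      change christoffelCurvature Γ p u (a • w) c = a • christoffelCurvature Γ p u w c
      simp only [christoffelCurvature_antisymm Γ p u, christoffelCurvature_smul_left, smul_neg])

lemma curvatureMap_apply {E : Type*} [NormedAddCommGroup E] [NormedSpace ℝ E]
    (Γ : E → E →L[ℝ] E →L[ℝ] E) (p u w c : E) :
    curvatureMap Γ p u w c = christoffelCurvature Γ p u w c := rfl

section Point

variable {M : Type*} [TopologicalSpace M] [ChartedSpace R3 M]

lemma eventually_of_chartDom {x : M} {Q : R3 → Prop}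
    (h : ∀ y ∈ chartDom x, Q (extChartAt (𝓡 3) x y)) : ∀ᶠ q in 𝓝 (extChartAt (𝓡 3) x x), Q q := by
  filter_upwards [extChartAt_target_mem_nhds x] with q hq
  rw [← (extChartAt (𝓡 3) x).right_inv hq]
  exact h _ ((extChartAt (𝓡 3) x).map_target hq)

variable [IsManifold (𝓡 3) ∞ M]

lemma mdifferentiableAt_extend {x y : M} (hy : y ∈ chartDom x) (c : TangentSpace (𝓡 3) x) :
    MDifferentiableAt (𝓡 3) (𝓡 3).tangent (fun z ↦
      (TotalSpace.mk' R3 z (FiberBundle.extend R3 c z) : TangentBundle (𝓡 3) M)) y :=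
  (mdifferentiableAt_coordField hy (toChart x x c)).congr_of_eventuallyEq (by
    filter_upwards [chartDom_mem_nhds hy] with z hz
    rw [extend_eq_coordField hz])

lemma toChart_cov_extend (cov : AffineConnection M) {x y : M} (hy : y ∈ chartDom x)
    (c : TangentSpace (𝓡 3) x) (u : TangentSpace (𝓡 3) y) :
    toChart x y (cov (FiberBundle.extend R3 c) y u) =
      christoffel cov x (extChartAt (𝓡 3) x y) (toChart x x c) (toChart x y u) := by
  rw [cov_congr cov (mdifferentiableAt_extend hy c) (Z' := coordField x (toChart x x c)) (by
    filter_upwards [chartDom_mem_nhds hy] with z hz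
    rw [extend_eq_coordField hz]), toChart_cov_coordField cov hy]

/-- The second covariant derivative in the chart at its base point. -/
lemma toChart_secondCov [T2Space M] {cov : AffineConnection M}
    (hcov : cov.ContMDiffCovariantDerivative ∞) (x : M) (u w c : TangentSpace (𝓡 3) x) :
    toChart x x (secondCov cov (FiberBundle.extend R3 c) x u w) =
      fderiv ℝ (christoffel cov x) (extChartAt (𝓡 3) x x) (toChart x x u) (toChart x x c)
        (toChart x x w) +
      christoffel cov x (extChartAt (𝓡 3) x x) (christoffel cov x (extChartAt (𝓡 3) x x)
        (toChart x x c) (toChart x x w)) (toChart x x u) -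
      christoffel cov x (extChartAt (𝓡 3) x x) (toChart x x c)
        (christoffel cov x (extChartAt (𝓡 3) x x) (toChart x x w) (toChart x x u)) := by
  have hx : x ∈ chartDom x := mem_extChartAt_source x
  have hΓ : DifferentiableAt ℝ (christoffel cov x) (extChartAt (𝓡 3) x x) :=
    (contDiffAt_christoffel hcov hx).differentiableAt (by simp)
  set Y : Π y : M, TangentSpace (𝓡 3) y :=
    fun y ↦ cov (FiberBundle.extend R3 c) y (FiberBundle.extend R3 w y) with hY
  have hval {y : M} (hy : y ∈ chartDom x) : toChart x y (Y y) =
      christoffel cov x (extChartAt (𝓡 3) x y) (toChart x x c) (toChart x x w) := by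
    rw [hY, toChart_cov_extend cov hy, extend_eq_coordField hy, coordField, toChart_fromChart hy]
  have hrep : chartRep x Y =ᶠ[𝓝 (extChartAt (𝓡 3) x x)]
      fun q ↦ christoffel cov x q (toChart x x c) (toChart x x w) := by
    refine eventually_of_chartDom fun y hy ↦ ?_
    rw [chartRep_extChartAt hy, hval hy]
  have hYd : MDifferentiableAt (𝓡 3) (𝓡 3).tangent
      (fun z ↦ (TotalSpace.mk' R3 z (Y z) : TangentBundle (𝓡 3) M)) x :=
    (mdifferentiableAt_field_iff hx).2
      ((hasFDerivAt_apply₂ hΓ _ _).differentiableAt.congr_of_eventuallyEq hrep)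
  rw [secondCov, map_sub, toChart_cov cov hx hYd u, hval hx, hrep.fderiv_eq, fderiv_apply₂ hΓ,
    toChart_cov_extend cov hx, toChart_cov_extend cov hx]

/-- The curvature that enters the Weyl tensor is the one computed from the Christoffel symbols. -/
lemma toChart_secondCov_sub [T2Space M] {cov : AffineConnection M}
    (hcov : cov.ContMDiffCovariantDerivative ∞) (ht : cov.torsion = 0) (x : M)
    (u w c : TangentSpace (𝓡 3) x) :
    toChart x x (secondCov cov (FiberBundle.extend R3 c) x u w -
      secondCov cov (FiberBundle.extend R3 c) x w u) =
      christoffelCurvature (christoffel cov x) (extChartAt (𝓡 3) x x) (toChart x x u)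
        (toChart x x w) (toChart x x c) := by
  rw [map_sub, toChart_secondCov hcov, toChart_secondCov hcov, christoffelCurvature,
    christoffel_symm ht (mem_extChartAt_source x) (toChart x x w) (toChart x x u)]
  abel

set_option synthInstance.maxHeartbeats 200000 in
/-- A symmetric form on one tangent space extends to a smooth tensor field. -/
lemma exists_symTwoTensor [T2Space M] (x : M) (t : LinearMap.BilinForm ℝ (TangentSpace (𝓡 3) x))
    (ht : ∀ u v, t u v = t v u) : ∃ T : SymTwoTensor M, ∀ u v, T.toFun x u v = t u v := by
  have hx : x ∈ chartDom x := mem_extChartAt_source x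
  obtain ⟨L, hL, hLs⟩ : ∃ L : R3 →L[ℝ] R3 →L[ℝ] ℝ, (∀ u v : R3, L u v = t u v) ∧
      ∀ u v, L u v = L v u := ⟨LinearMap.toContinuousBilinearMap t, fun u v ↦ rfl, ht⟩
  obtain ⟨f, -, hf⟩ := ((SmoothBumpFunction.nhds_basis_tsupport (I := 𝓡 3) x).mem_iff).1
    (chartDom_mem_nhds hx)
  set A : Π y : M, TangentSpace (𝓡 3) y →L[ℝ] TangentSpace (𝓡 3) y →L[ℝ] ℝ :=
    fun y ↦ ContinuousLinearMap.precomp ℝ (toChart x y) ∘L L ∘L toChart x y with hA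
  refine ⟨⟨fun y ↦ f y • A y, fun y u v ↦ ?_, ?_⟩, fun u v ↦ ?_⟩
  · change f y * L (toChart x y u) (toChart x y v) = f y * L (toChart x y v) (toChart x y u)
    rw [hLs]
  · refine ContMDiffOn.smul_section_of_tsupport (s := A) f.contMDiff.contMDiffOn
      (isOpen_extChartAt_source x) hf fun y hy ↦ ContMDiffAt.contMDiffWithinAt ?_
    have hmem := mem_baseSet_of_mem_chartDom hy
    rw [(trivializationAt (R3 →L[ℝ] R3 →L[ℝ] ℝ) (fun x : M ↦ TangentSpace (𝓡 3) x →L[ℝ]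
      TangentSpace (𝓡 3) x →L[ℝ] ℝ) x).contMDiffAt_section_iff (by simpa using hmem)]
    refine (contMDiffAt_const (c := L)).congr_of_eventuallyEq ?_
    filter_upwards [chartDom_mem_nhds hy] with z hz
    ext v w
    rw [tensor_trivialization_apply hz]
    change L (toChart x z (fromChart x z v)) (toChart x z (fromChart x z w)) = _
    rw [toChart_fromChart hz, toChart_fromChart hz]
  · change (f x • A x) u v = _
    rw [f.eq_one, one_smul]
    change L (toChart x x u) (toChart x x v) = _
    rw [toChart_self, toChart_self]
    exact hL u v

end Point

/-! ### Metrisable connections -/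

section Metrisable

variable {M : Type*} [TopologicalSpace M] [ChartedSpace R3 M] [IsManifold (𝓡 3) ∞ M]

/-- The components of a metric at `x` in the chart at `x`, as a bilinear form on the model space. -/
def MetricTensor.chartForm (g : MetricTensor M) (x : M) : LinearMap.BilinForm ℝ R3 :=
  LinearMap.mk₂ ℝ (fun v w ↦ tensorRep g.toSymTwoTensor x (extChartAt (𝓡 3) x x) v w)
    (by simp) (by simp) (by simp) (by simp)

lemma MetricTensor.chartForm_symm (g : MetricTensor M) (x : M) (u v : R3) :
    g.chartForm x u v = g.chartForm x v u := by
  have hx : x ∈ chartDom x := mem_extChartAt_source x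
  simp only [MetricTensor.chartForm, LinearMap.mk₂_apply, tensorRep_apply _ hx]
  exact g.symm x _ _

lemma MetricTensor.chartForm_nondegenerate (g : MetricTensor M) (x : M) :
    (g.chartForm x).Nondegenerate := by
  have hx : x ∈ chartDom x := mem_extChartAt_source x
  refine LinearMap.BilinForm.Nondegenerate.ofSeparatingLeft fun u hu ↦ ?_
  simp only [MetricTensor.chartForm, LinearMap.mk₂_apply, tensorRep_apply _ hx] at hu
  have h := g.nondegenerate x (coordField x u x) fun v ↦ by
    rw [← fromChart_toChart hx v]
    exact hu (toChart x x v)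
  rw [← toChart_fromChart hx u]
  exact (congrArg _ h).trans (map_zero _)

variable [T2Space M]

lemma trace_curvatureMap {cov : AffineConnection M} (hsmooth : cov.ContMDiffCovariantDerivative ∞)
    {ε : VolumeForm M} (hε : IsParallelVolume cov ε) (x : M) (u w : R3) :
    LinearMap.trace ℝ R3 (curvatureMap (christoffel cov x) (extChartAt (𝓡 3) x x) u w) = 0 := by
  have hx : x ∈ chartDom x := mem_extChartAt_source x
  have h := christoffelCurvature_trace
    ((contDiffAt_christoffel hsmooth hx).differentiableAt (by simp))
    (contDiffAt_volumeRep ε hx) (volumeRep_ne_zero ε hx)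
    (eventually_of_chartDom fun y hy ↦ fderiv_volumeRep hε hy) u w
  rw [trace_eq_sum_repr (EuclideanSpace.basisFun (Fin 3) ℝ).toBasis]
  simpa [curvatureMap_apply] using h

/-- The curvatures at a point of two torsion-free connections with the same geodesics. -/
lemma exists_curvatureMap_projective {D cov : AffineConnection M}
    (hD : D.ContMDiffCovariantDerivative ∞) (hDt : D.torsion = 0)
    (hsmooth : cov.ContMDiffCovariantDerivative ∞) (htorsion : cov.torsion = 0)
    (h : ProjectivelyEquivalent D cov) (x : M) :
    ∃ P : R3 → R3 → ℝ, ∀ u w c,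
      curvatureMap (christoffel cov x) (extChartAt (𝓡 3) x x) u w c =
        curvatureMap (christoffel D x) (extChartAt (𝓡 3) x x) u w c +
          (P u w - P w u) • c + P u c • w - P w c • u := by
  have hx : x ∈ chartDom x := mem_extChartAt_source x
  have h1 : DifferentiableAt ℝ (christoffel D x) (extChartAt (𝓡 3) x x) :=
    (contDiffAt_christoffel hD hx).differentiableAt (by simp)
  have h2 : DifferentiableAt ℝ (christoffel cov x) (extChartAt (𝓡 3) x x) :=
    (contDiffAt_christoffel hsmooth hx).differentiableAt (by simp)
  obtain ⟨η, hη, hηd, hA⟩ := exists_christoffel_projective h1 h2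
    (eventually_of_chartDom fun y hy ↦ christoffel_symm hDt hy)
    (eventually_of_chartDom fun y hy ↦ christoffel_symm htorsion hy)
    (eventually_of_chartDom fun y hy ↦ exists_christoffel_sub_eq_smul hD h hy)
  exact exists_christoffelCurvature_projective h1 h2 (christoffel_symm hDt hx) (hη _) hηd hA

lemma MetricTensor.chartForm_skew {g : MetricTensor M} {D : AffineConnection M}
    (h : IsLeviCivita D g) (x : M) (u v c d : R3) :
    g.chartForm x (curvatureMap (christoffel D x) (extChartAt (𝓡 3) x x) u v c) d +
      g.chartForm x c (curvatureMap (christoffel D x) (extChartAt (𝓡 3) x x) u v d) = 0 :=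
  have hx : x ∈ chartDom x := mem_extChartAt_source x
  christoffelCurvature_skew ((contDiffAt_christoffel h.smooth hx).differentiableAt (by simp))
    (contDiffAt_tensorRep _ hx) (eventually_of_chartDom fun y hy ↦ fderiv_tensorRep h hy) u v c d

/-- At a point where the Weyl tensor of a metrisable connection does not vanish, some symmetric form
has a non-degenerate pencil, in every basis of the tangent space. -/
lemma exists_pencil_det_ne_zero {cov : AffineConnection M}
    (hsmooth : cov.ContMDiffCovariantDerivative ∞) (htorsion : cov.torsion = 0)
    {ε : VolumeForm M} (hε : IsParallelVolume cov ε) (hmetrisable : IsMetrisable cov) (x : M)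
    (B₀ : Module.Basis (Fin 3) ℝ R3) (hW : ∃ a b c, weylComponent
      (curvatureMap (christoffel cov x) (extChartAt (𝓡 3) x x)) B₀ a b c ≠ 0) :
    ∃ t : LinearMap.BilinForm ℝ R3, (∀ u v, t u v = t v u) ∧
      ∀ B : Module.Basis (Fin 3) ℝ R3, (Matrix.of fun b c ↦ ∑ a, ∑ d, ∑ e, t (B a) (B d) *
        ((weylComponent (curvatureMap (christoffel cov x) (extChartAt (𝓡 3) x x)) B a b e *
            levi c d e +
          weylComponent (curvatureMap (christoffel cov x) (extChartAt (𝓡 3) x x)) B a c e *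
            levi b d e) / 2)).det ≠ 0 := by
  obtain ⟨g, D, hLC, hPE⟩ := hmetrisable
  have hx : x ∈ chartDom x := mem_extChartAt_source x
  obtain ⟨P, hP⟩ := exists_curvatureMap_projective hLC.smooth hLC.torsion_eq_zero hsmooth htorsion
    hPE x
  exact exists_symm_pencil_det_ne_zero (g := g.chartForm x)
    (R := curvatureMap (christoffel D x) (extChartAt (𝓡 3) x x)) (P := P) (g.chartForm_symm x)
    (g.chartForm_nondegenerate x) (fun u v w ↦ christoffelCurvature_antisymm _ _ u v w)
    (christoffelCurvature_bianchi
      ((contDiffAt_christoffel hLC.smooth hx).differentiableAt (by simp))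
      (eventually_of_chartDom fun y hy ↦ christoffel_symm hLC.torsion_eq_zero hy))
    (MetricTensor.chartForm_skew hLC x) hP (trace_curvatureMap hsmooth hε x) B₀ hW

end Metrisable

end

theorem mainTheorem5 {M : Type*} [TopologicalSpace M] [T2Space M] [ChartedSpace R3 M]
    [IsManifold (𝓡 3) ∞ M]
    (cov : AffineConnection M) (hsmooth : cov.ContMDiffCovariantDerivative ∞)
    (htorsion : cov.torsion = 0)
    (ε : VolumeForm M) (hε : IsParallelVolume cov ε)
    (hV : ∃ (x : M) (B : Module.Basis (Fin 3) ℝ (TangentSpace (𝓡 3) x)) (a b c : Fin 3),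
      weyl cov ε B a b c ≠ 0)
    (hmetrisable : IsMetrisable cov) :
    ∃ (T : SymTwoTensor M) (x : M),
      ∀ B : Module.Basis (Fin 3) ℝ (TangentSpace (𝓡 3) x),
        tensorDet ε B (weylPencil cov ε T B) ≠ 0 := by
  obtain ⟨x, B₀, a, b, c, hW⟩ := hV
  -- the chart at `x` identifies `T_xM` with the model space by the identity map
  obtain ⟨R, hR, hRdef⟩ : ∃ R : TangentSpace (𝓡 3) x →ₗ[ℝ] TangentSpace (𝓡 3) x →ₗ[ℝ]
      TangentSpace (𝓡 3) x →ₗ[ℝ] TangentSpace (𝓡 3) x,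
      (∀ u v w, R u v w = secondCov cov (FiberBundle.extend R3 w) x u v -
        secondCov cov (FiberBundle.extend R3 w) x v u) ∧
      R = curvatureMap (christoffel cov x) (extChartAt (𝓡 3) x x) := by
    refine ⟨curvatureMap (christoffel cov x) (extChartAt (𝓡 3) x x), fun u v w ↦ ?_, rfl⟩
    have := toChart_secondCov_sub hsmooth htorsion x u v w
    rw [toChart_self, toChart_self, toChart_self, toChart_self] at this
    exact this.symm
  have hW' : ∃ a b c, weylComponent R B₀ a b c ≠ 0 :=
    ⟨a, b, c, fun h ↦ hW (by rw [weyl_eq B₀ cov ε hR, h, mul_zero])⟩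
  obtain ⟨t, ht, hdet⟩ : ∃ t : LinearMap.BilinForm ℝ (TangentSpace (𝓡 3) x),
      (∀ u v, t u v = t v u) ∧ ∀ B : Module.Basis (Fin 3) ℝ (TangentSpace (𝓡 3) x),
        (Matrix.of fun b c ↦ ∑ a, ∑ d, ∑ e, t (B a) (B d) * ((weylComponent R B a b e *
          levi c d e + weylComponent R B a c e * levi b d e) / 2)).det ≠ 0 := by
    subst hRdef
    exact exists_pencil_det_ne_zero hsmooth htorsion hε hmetrisable x B₀ hW'
  obtain ⟨T, hT⟩ := exists_symTwoTensor x t ht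
  refine ⟨T, x, fun B ↦ ?_⟩
  have he := ε.lower_ne_zero B
  have hpencil : Matrix.of (weylPencil cov ε T B) = (ε.lower B 0 1 2)⁻¹ ^ 2 •
      Matrix.of fun b c ↦ ∑ a, ∑ d, ∑ e, t (B a) (B d) * ((weylComponent R B a b e *
        levi c d e + weylComponent R B a c e * levi b d e) / 2) := by
    ext b c
    simp only [Matrix.of_apply, Matrix.smul_apply, smul_eq_mul, weylPencil_eq B cov ε T hR, hT]
  rw [tensorDet_eq, hpencil, Matrix.det_smul]
  exact mul_ne_zero (pow_ne_zero 2 he) (mul_ne_zero (by norm_num)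
    (mul_ne_zero (pow_ne_zero _ (pow_ne_zero 2 (inv_ne_zero he))) (hdet B)))
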